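/- Let $(x,y,z)$ be the standard coordinates on $\mathbb R^3$, let $E=x\partial_x+y\partial_y$ and $T=-y\partial_x+x\partial_y$, and for a real number $\tau>0$ let $\pi_\tau=(\tau E+T)\wedge\partial_z$. Let $\mathfrak X^k(\mathbb R^3)$ be the space of smooth $k$-vector fields and $[\cdot,\cdot]$ the Schouten–Nijenhuis bracket. Then $[\pi_\tau,\pi_\tau]=0$, i.e. $\pi_\tau$ is a Poisson structure, so $d_{\pi_\tau}=[\pi_\tau,\cdot]$ is a differential on $\mathfrak X^\bullet(\mathbb R^3)$. Let $H^\bullet=H^\bullet(\mathbb R^3,\pi_\tau)$ be its cohomology (the Poisson cohomology), and let the Casimir functions be the $f\in C^\infty(\mathbb R^3)$ with $d_{\pi_\tau}f=0$; they form a ring, $H^0$, over which every $H^k$ is a module. Then: 1. the Casimir functions are exactly the constant functions, so that $H^0=\mathbb R$, with basis the class of $1$; 2. $H^1$ is a free module over the Casimir functions, with basis the classes of $E$ and $\partial_z$; 3. $H^2$ is a free module over the Casimir functions, with basis the class of $E\wedge\partial_z$; 4. $H^3=0$. Moreover, the algebraic structure of $H^\bullet$ is given by the operations on these representatives. That is,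 the wedge product and the Schouten–Nijenhuis bracket of cocycles descend to bilinear maps $H^i\times H^j\to H^{i+j}$ and $H^i\times H^j\to H^{i+j-1}$; the real span of $1,E,\partial_z,E\wedge\partial_z$ is closed under the wedge product and the bracket vanishes identically on it; in cohomology, $[1]$ is the unit, $[E]\wedge[E]=[\partial_z]\wedge[\partial_z]=0$, $[E]\wedge[\partial_z]=-[\partial_z]\wedge[E]=[E\wedge\partial_z]$, and the induced bracket on $H^\bullet$ is zero. -/

import Mathlib

open scoped TensorProduct ContDiff

noncomputable section

namespace PoissonR3

/-- The space `ℝ³`, with coordinates `x = p 0`, `y = p 1`, `z = p 2`. -/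
abbrev Space : Type := Fin 3 → ℝ

/-- The algebra `C^∞(ℝ³)` of smooth real functions on `ℝ³`. -/
def smoothFun : Subalgebra ℝ (Space → ℝ) where
  carrier := {f | ContDiff ℝ ∞ f}
  mul_mem' := by
    intro f g hf hg
    simp only [Set.mem_ofPred_eq] at hf hg ⊢
    exact hf.mul hg
  add_mem' := by
    intro f g hf hg
    simp only [Set.mem_ofPred_eq] at hf hg ⊢
    exact hf.add hg
  algebraMap_mem' := by
    intro c
    simp only [Set.mem_ofPred_eq]
    exact contDiff_const (c := c)

theorem mem_smoothFun {f : Space → ℝ} : f ∈ smoothFun ↔ ContDiff ℝ ∞ f := Iff.rfl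

/-- The type of smooth real functions on `ℝ³`. -/
abbrev SmoothFun : Type := smoothFun

instance : CommRing SmoothFun := inferInstance

instance : AddCommGroup SmoothFun := inferInstance

/-- The algebra `𝔛^•(ℝ³) = C^∞(ℝ³) ⊗ Λ^• ℝ³` of multivector fields on `ℝ³`
(the multiplication is the wedge product). -/
abbrev MultiVec : Type := SmoothFun ⊗[ℝ] ExteriorAlgebra ℝ Space

instance : AddCommGroup MultiVec := inferInstance

instance : Ring MultiVec := inferInstance

instance : Module SmoothFun MultiVec := TensorProduct.leftModule

instance : Module ℝ MultiVec := TensorProduct.leftModule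

/-- The submodule `𝔛^k(ℝ³) = C^∞(ℝ³) ⊗ Λ^k ℝ³` of `k`-vector fields. -/
def kVec (k : ℕ) : Submodule SmoothFun MultiVec :=
  (⋀[ℝ]^k Space).baseChange SmoothFun

/-- The coordinate function `p ↦ p i`. -/
def coord (i : Fin 3) : SmoothFun :=
  ⟨fun p => p i, mem_smoothFun.2 (contDiff_apply ℝ ℝ i)⟩

theorem smooth_differentiable (f : SmoothFun) : Differentiable ℝ (f : Space → ℝ) :=
  (mem_smoothFun.1 f.2).differentiable (by simp)

/-- The partial derivative `∂/∂x_i` on smooth functions. -/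
def pderiv (i : Fin 3) : SmoothFun →ₗ[ℝ] SmoothFun where
  toFun f := ⟨fun p => fderiv ℝ (f : Space → ℝ) p (Pi.single i 1),
    mem_smoothFun.2
      (((mem_smoothFun.1 f.2).fderiv_right (m := ∞) (by simp)).clm_apply contDiff_const)⟩
  map_add' f g := by
    ext p
    change fderiv ℝ ((f : Space → ℝ) + (g : Space → ℝ)) p _ = fderiv ℝ f p _ + fderiv ℝ g p _
    rw [fderiv_add (smooth_differentiable f p) (smooth_differentiable g p)]
    rfl
  map_smul' c f := by
    ext p
    change fderiv ℝ (c • (f : Space → ℝ)) p _ = c • fderiv ℝ f p _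
    rw [fderiv_const_smul (smooth_differentiable f p)]
    rfl

theorem pderiv_mul (i : Fin 3) (f g : SmoothFun) :
    pderiv i (f * g) = f * pderiv i g + pderiv i f * g := by
  ext p
  change fderiv ℝ ((f : Space → ℝ) * (g : Space → ℝ)) p _ =
    (f : Space → ℝ) p * fderiv ℝ g p _ + fderiv ℝ f p _ * (g : Space → ℝ) p
  rw [fderiv_mul (smooth_differentiable f p) (smooth_differentiable g p)]
  simp [mul_comm]

/-- The partial derivative `∂/∂x_i` applied to the coefficients of a multivector field. -/
def coeffDeriv (i : Fin 3) : MultiVec →ₗ[ℝ] MultiVec :=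
  (pderiv i).rTensor (ExteriorAlgebra ℝ Space)

/-- Contraction with `dx_i` from the left (the left derivative with respect to `∂_i`). -/
def contrL (i : Fin 3) : MultiVec →ₗ[SmoothFun] MultiVec :=
  (CliffordAlgebra.contractLeft (Q := (0 : QuadraticForm ℝ Space))
    (LinearMap.proj i : Module.Dual ℝ Space)).baseChange SmoothFun

/-- Contraction with `dx_i` from the right (the right derivative with respect to `∂_i`). -/
def contrR (i : Fin 3) : MultiVec →ₗ[SmoothFun] MultiVec :=
  ((CliffordAlgebra.contractRight (Q := (0 : QuadraticForm ℝ Space))).flip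
    (LinearMap.proj i : Module.Dual ℝ Space)).baseChange SmoothFun

/-- The Schouten-Nijenhuis bracket of multivector fields on `ℝ³`,
`[P, Q] = ∑ i, (P ⌊ dx_i) ∧ ∂_i Q - ∂_i P ∧ (dx_i ⌋ Q)`.
It is the commutator on vector fields, and `[X, f] = X(f)`. -/
def schouten : MultiVec →ₗ[ℝ] MultiVec →ₗ[ℝ] MultiVec :=
  ∑ i : Fin 3,
    ((LinearMap.mul ℝ MultiVec).compl₁₂ ((contrR i).restrictScalars ℝ) (coeffDeriv i) -
      (LinearMap.mul ℝ MultiVec).compl₁₂ (coeffDeriv i) ((contrL i).restrictScalars ℝ))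

theorem schouten_apply (P Q : MultiVec) :
    schouten P Q =
      ∑ i : Fin 3, (contrR i P * coeffDeriv i Q - coeffDeriv i P * contrL i Q) := by
  simp [schouten]

/-- The Poisson differential `d_π = [π, ·]`. -/
def dPoisson (π : MultiVec) : MultiVec →ₗ[ℝ] MultiVec := schouten π

theorem coeffDeriv_smul (i : Fin 3) (f : SmoothFun) (P : MultiVec) :
    coeffDeriv i (f • P) = f • coeffDeriv i P + pderiv i f • P := by
  induction P using TensorProduct.induction_on with
  | zero => simp
  | tmul g w => simp [coeffDeriv, TensorProduct.smul_tmul', pderiv_mul, TensorProduct.add_tmul]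
  | add P Q hP hQ => simp only [smul_add, map_add, hP, hQ]; abel

theorem contrL_one (i : Fin 3) (f : SmoothFun) : contrL i (f ⊗ₜ 1) = 0 := by
  simp [contrL]

theorem dPoisson_fun (π : MultiVec) (f : SmoothFun) :
    dPoisson π (f ⊗ₜ 1) = ∑ i : Fin 3, pderiv i f • contrR i π := by
  rw [dPoisson, schouten_apply]
  refine Finset.sum_congr rfl fun i _ => ?_
  have h : coeffDeriv i (f ⊗ₜ[ℝ] (1 : ExteriorAlgebra ℝ Space))
      = pderiv i f • (1 : MultiVec) := by
    simp [coeffDeriv, Algebra.TensorProduct.one_def, TensorProduct.smul_tmul']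
  rw [h, contrL_one, mul_zero, sub_zero, mul_smul_comm, mul_one]

theorem dPoisson_smul (π : MultiVec) (f : SmoothFun) (P : MultiVec) :
    dPoisson π (f • P) = f • dPoisson π P + dPoisson π (f ⊗ₜ 1) * P := by
  rw [dPoisson_fun, dPoisson, schouten_apply, schouten_apply, Finset.smul_sum, Finset.sum_mul,
    ← Finset.sum_add_distrib]
  refine Finset.sum_congr rfl fun i _ => ?_
  rw [coeffDeriv_smul, map_smul, mul_add, mul_smul_comm, mul_smul_comm, mul_smul_comm,
    smul_mul_assoc, smul_sub]
  abel

/-- The algebra of Casimir functions of `π`: the smooth functions `f` with `d_π f = 0`. -/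
def casimirs (π : MultiVec) : Subalgebra ℝ SmoothFun where
  carrier := {f | dPoisson π (f ⊗ₜ 1) = 0}
  mul_mem' := by
    intro f g hf hg
    have h : (f * g) ⊗ₜ[ℝ] (1 : ExteriorAlgebra ℝ Space) = f • (g ⊗ₜ[ℝ] 1) := by
      simp [TensorProduct.smul_tmul']
    simp only [Set.mem_ofPred_eq] at hf hg ⊢
    rw [h, dPoisson_smul, hf, hg, smul_zero, zero_mul, add_zero]
  add_mem' := by
    intro f g hf hg
    simp only [Set.mem_ofPred_eq] at hf hg ⊢
    rw [TensorProduct.add_tmul, map_add, hf, hg, add_zero]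
  algebraMap_mem' := by
    intro c
    have h (i : Fin 3) : pderiv i (algebraMap ℝ SmoothFun c) = 0 := by
      ext p
      change fderiv ℝ (fun _ : Space => c) p _ = 0
      simp
    simp only [Set.mem_ofPred_eq, dPoisson_fun, h, zero_smul, Finset.sum_const_zero]

instance (π : MultiVec) : CommRing (casimirs π) := inferInstance

instance (π : MultiVec) : Module (casimirs π) MultiVec := inferInstance

instance (π : MultiVec) : IsScalarTower ℝ (casimirs π) MultiVec :=
  ⟨fun c f P => smul_assoc c (f : SmoothFun) P⟩

theorem dPoisson_casimir_smul {π : MultiVec} (f : casimirs π) (P : MultiVec) :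
    dPoisson π (f • P) = f • dPoisson π P := by
  have hf : dPoisson π ((f : SmoothFun) ⊗ₜ 1) = 0 := f.2
  change dPoisson π ((f : SmoothFun) • P) = (f : SmoothFun) • dPoisson π P
  rw [dPoisson_smul, hf, zero_mul, add_zero]

/-- The `k`-cocycles of the Poisson complex: the `k`-vector fields `P` with `d_π P = 0`. -/
def cocycles (π : MultiVec) (k : ℕ) : Submodule (casimirs π) MultiVec where
  carrier := {P | P ∈ kVec k ∧ dPoisson π P = 0}
  add_mem' := fun hP hQ => ⟨add_mem hP.1 hQ.1, by rw [map_add, hP.2, hQ.2, add_zero]⟩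
  zero_mem' := ⟨zero_mem _, map_zero _⟩
  smul_mem' := fun f P hP =>
    ⟨(kVec k).smul_mem (f : SmoothFun) hP.1, by rw [dPoisson_casimir_smul, hP.2, smul_zero]⟩

instance (π : MultiVec) (k : ℕ) : AddCommGroup (cocycles π k) :=
  Submodule.addCommGroup _

instance (π : MultiVec) (k : ℕ) : Module (casimirs π) (cocycles π k) :=
  Submodule.module _

/-- The `k`-coboundaries of the Poisson complex: `d_π` of the `(k-1)`-vector fields,
and `0` for `k = 0`. -/
def coboundaries (π : MultiVec) : ℕ → Submodule (casimirs π) MultiVec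
  | 0 => ⊥
  | k + 1 =>
    { carrier := {Q | ∃ P ∈ kVec k, dPoisson π P = Q}
      add_mem' := by
        rintro _ _ ⟨P, hP, rfl⟩ ⟨Q, hQ, rfl⟩
        exact ⟨P + Q, add_mem hP hQ, map_add _ _ _⟩
      zero_mem' := ⟨0, zero_mem _, map_zero _⟩
      smul_mem' := by
        rintro f _ ⟨P, hP, rfl⟩
        exact ⟨f • P, (kVec k).smul_mem (f : SmoothFun) hP, dPoisson_casimir_smul f P⟩ }

/-- The Poisson cohomology group `H^k(ℝ³, π)`. -/
def Cohomology (π : MultiVec) (k : ℕ) : Type :=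
  cocycles π k ⧸ (coboundaries π k).submoduleOf (cocycles π k)

instance (π : MultiVec) (k : ℕ) : AddCommGroup (Cohomology π k) :=
  Submodule.Quotient.addCommGroup _

instance (π : MultiVec) (k : ℕ) : Module (casimirs π) (Cohomology π k) :=
  Submodule.Quotient.module _

instance (π : MultiVec) (k : ℕ) : Module ℝ (Cohomology π k) :=
  Module.compHom _ (algebraMap ℝ (casimirs π))

instance (π : MultiVec) (k : ℕ) : IsScalarTower ℝ (casimirs π) (Cohomology π k) :=
  ⟨fun c f a => by
    change (c • f) • a = algebraMap ℝ (casimirs π) c • f • a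
    rw [Algebra.smul_def, mul_smul]⟩

/-- The cohomology class of a cocycle. -/
def cls {π : MultiVec} {k : ℕ} : cocycles π k →ₗ[casimirs π] Cohomology π k :=
  Submodule.mkQ _

theorem cls_surjective {π : MultiVec} {k : ℕ} :
    Function.Surjective (cls : cocycles π k →ₗ[casimirs π] Cohomology π k) :=
  Submodule.mkQ_surjective _

theorem cls_eq_iff {π : MultiVec} {k : ℕ} (P Q : cocycles π k) :
    cls P = cls Q ↔ (P - Q : MultiVec) ∈ coboundaries π k :=
  Submodule.Quotient.eq _

/-- The coordinate vector field `∂_i`. -/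
def partialVec (i : Fin 3) : MultiVec :=
  1 ⊗ₜ ExteriorAlgebra.ι ℝ (Pi.single i 1)

/-- `E = x ∂_x + y ∂_y`. -/
def eulerVec : MultiVec := coord 0 • partialVec 0 + coord 1 • partialVec 1

/-- `T = -y ∂_x + x ∂_y`. -/
def rotVec : MultiVec := -(coord 1 • partialVec 0) + coord 0 • partialVec 1

/-- `π_τ = (τ E + T) ∧ ∂_z`. -/
def spiralPoisson (τ : ℝ) : MultiVec := (τ • eulerVec + rotVec) * partialVec 2

end PoissonR3

end

open PoissonR3

/-! Write V = τE + T, a linear vector field in the (x, y)-plane that commutes with ∂_z, so that π_τ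
= V ∧ ∂_z. For a function f, a vector field W in the ∂_x, ∂_y directions and a function g, the
differential is d f = f_z V - V(f) ∂_z and d(W + g ∂_z) = V ∧ W_z + ([V, W] + g_z V) ∧ ∂_z. On
bivector fields it involves the divergence 2τ of V, which is nonzero; this gives H³ = 0 and removes
the ∂_x ∧ ∂_y component of a 2-cocycle.

Smooth functions have z-primitives, and a vector field in the plane directions parallel to V is a
smooth multiple of V (`exists_eq_spiral_mul`). Together these make every cocycle in degrees 1 and 2
cohomologous to one whose plane part is independent of z. What remains is the kernel and cokernel of
V on functions and of [V, ·] on vector fields in the plane. With ζ = x + iy and a∂_x + b∂_y written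
as a + ib, the second operator is V - (τ + i).

The equation V X - κX = F is solved for Re κ < 0 by integrating e^{κt} F along the backward flow,
which contracts to the origin (`exists_solution_of_re_neg`). Hadamard's lemma splits F into F(0), a
multiple of ζ and a multiple of its conjugate. These are eigenfunctions of V with eigenvalues τ ± i,
and dividing by one of them lowers Re κ by τ. Repeating this reaches Re κ = 0 and κ = τ + i; the
only obstructions are constants for κ = 0 and multiples of ζ for κ = τ + i. The kernels are the same
spaces: a solution is carried to the origin by the flow, and it is determined there by its value or
its derivative.

The complex line spanned by ζ corresponds to the real span of E and V. Since V ∧ ∂_z = d(z ∂_z), and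
V = d(z), only E survives; this gives the classes E, ∂_z and E ∧ ∂_z. The wedge product and the
bracket descend by derivation and Jacobi identities, needed only in low degrees because everything
of degree at least 3 is exact. -/

noncomputable section
namespace PoissonR3
open MeasureTheory Filter Topology

/-! ### Smooth dependence of integrals on parameters, and Hadamard's lemma -/

section ParametricIntegral

variable {E : Type} [NormedAddCommGroup E] [NormedSpace ℝ E] [ProperSpace E]

/-- The maps `A t` send the unit ball around `p` into one fixed compact ball. This supplies the
locally uniform domination for differentiating under the integral. -/
theorem exists_bound_comp_linear {G : Type} [NormedAddCommGroup G] {S : Set ℝ} {A : ℝ → E →L[ℝ] E} {M : ℝ}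
    (hM : ∀ t ∈ S, ‖A t‖ ≤ M) {F : E → G} (hF : Continuous F) (p : E) :
    ∃ C, ∀ t ∈ S, ∀ q ∈ Metric.ball p 1, ‖F (A t q)‖ ≤ C := by
  obtain ⟨C, hC⟩ := (isCompact_closedBall (0 : E) (M * (‖p‖ + 1))).exists_bound_of_continuousOn
    hF.continuousOn
  refine ⟨C, fun t ht q hq => hC _ ?_⟩
  rw [mem_closedBall_zero_iff]
  have h1 : ‖q‖ ≤ ‖p‖ + 1 := by
    have h2 : ‖q - p‖ < 1 := mem_ball_iff_norm.1 hq
    have h3 := norm_le_norm_add_norm_sub p q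
    rw [norm_sub_rev] at h2
    linarith
  exact ((A t).le_opNorm q).trans
    (mul_le_mul (hM t ht) h1 (norm_nonneg _) ((norm_nonneg _).trans (hM t ht)))

variable {G H : Type} [NormedAddCommGroup G] [NormedSpace ℝ G] [NormedAddCommGroup H]
  [NormedSpace ℝ H]

/-- The derivative of the coefficient family under the integral sign. -/
def derivCoeff (A : ℝ → E →L[ℝ] E) (c : ℝ → G →L[ℝ] H) (t : ℝ) : (E →L[ℝ] G) →L[ℝ] (E →L[ℝ] H) :=
  ((ContinuousLinearMap.compL ℝ E G H) (c t)).comp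
    ((ContinuousLinearMap.compL ℝ E E G).flip (A t))

theorem integrable_param {S : Set ℝ} (hS : MeasurableSet S) {A : ℝ → E →L[ℝ] E}
    (hA : Continuous A) {M : ℝ} (hM : ∀ t ∈ S, ‖A t‖ ≤ M) {c : ℝ → G →L[ℝ] H}
    (hc : Continuous c) {b : ℝ → ℝ} (hb : IntegrableOn b S) (hcb : ∀ t ∈ S, ‖c t‖ ≤ b t)
    {F : E → G} (hF : Continuous F) (p : E) :
    IntegrableOn (fun t => c t (F (A t p))) S := by
  obtain ⟨C, hC⟩ := exists_bound_comp_linear hM hF p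
  have hcont : Continuous fun t => c t (F (A t p)) :=
    hc.clm_apply (hF.comp (hA.clm_apply continuous_const))
  refine Integrable.mono' (hb.mul_const C) hcont.aestronglyMeasurable ?_
  refine (ae_restrict_iff' hS).2 (Eventually.of_forall fun t ht => ?_)
  exact ((c t).le_opNorm _).trans (mul_le_mul (hcb t ht)
    (hC t ht p (Metric.mem_ball_self one_pos)) (norm_nonneg _) ((norm_nonneg _).trans (hcb t ht)))

theorem hasFDerivAt_param {S : Set ℝ} (hS : MeasurableSet S) {A : ℝ → E →L[ℝ] E}
    (hA : Continuous A) {M : ℝ} (hM : ∀ t ∈ S, ‖A t‖ ≤ M) {c : ℝ → G →L[ℝ] H}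
    (hc : Continuous c) {b : ℝ → ℝ} (hb : IntegrableOn b S) (hcb : ∀ t ∈ S, ‖c t‖ ≤ b t)
    {F : E → G} (hF : ContDiff ℝ ∞ F) (p : E) :
    HasFDerivAt (fun p => ∫ t in S, c t (F (A t p)))
      (∫ t in S, derivCoeff A c t (fderiv ℝ F (A t p))) p := by
  have hF' : Continuous (fderiv ℝ F) := hF.continuous_fderiv (by simp)
  obtain ⟨C, hC⟩ := exists_bound_comp_linear hM hF' p
  have hcont (q : E) : Continuous fun t => c t (F (A t q)) :=
    hc.clm_apply (hF.continuous.comp (hA.clm_apply continuous_const))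
  refine hasFDerivAt_integral_of_dominated_of_fderiv_le (𝕜 := ℝ)
    (F' := fun q t => derivCoeff A c t (fderiv ℝ F (A t q))) (bound := fun t => b t * (C * M))
    (Metric.ball_mem_nhds p one_pos)
    (Eventually.of_forall fun q => (hcont q).aestronglyMeasurable)
    (integrable_param hS hA hM hc hb hcb hF.continuous p) ?_ ?_ (hb.mul_const _) ?_
  · have h1 : Continuous (derivCoeff A c) := by
      unfold derivCoeff
      fun_prop
    -- Strong measurability into a space of operators needs a second countable side; the parameter
    -- line provides it.
    have : SecondCountableTopologyEither ℝ (E →L[ℝ] H) := secondCountableTopologyEither_of_left ℝ _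
    exact (h1.clm_apply (hF'.comp (hA.clm_apply continuous_const))).aestronglyMeasurable
  · refine (ae_restrict_iff' hS).2 (Eventually.of_forall fun t ht q hq => ?_)
    have h2 : derivCoeff A c t (fderiv ℝ F (A t q)) = (c t).comp ((fderiv ℝ F (A t q)).comp (A t)) :=
      rfl
    rw [h2]
    refine (ContinuousLinearMap.opNorm_comp_le _ _).trans ?_
    have hM0 := (norm_nonneg _).trans (hM t ht)
    refine mul_le_mul (hcb t ht) ((ContinuousLinearMap.opNorm_comp_le _ _).trans ?_)
      (norm_nonneg _) ((norm_nonneg _).trans (hcb t ht))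
    exact mul_le_mul (hC t ht q hq) (hM t ht) (norm_nonneg _)
      ((norm_nonneg _).trans (hC t ht q hq))
  · refine Eventually.of_forall fun t q _ => ?_
    exact (c t).hasFDerivAt.comp q
      (((hF.differentiable (by simp)) (A t q)).hasFDerivAt.comp q (A t).hasFDerivAt)

/-- The derivative is an integral of the same shape, with `fderiv ℝ F` for `F`, `derivCoeff A c` for
`c` and `b * M` for `b`. Its values lie in other spaces, so `G` and `H` are quantified inside the
induction, and the coefficient `c` is operator valued. -/
theorem contDiff_param_nat (n : ℕ) : ∀ {G H : Type} [NormedAddCommGroup G] [NormedSpace ℝ G]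
    [NormedAddCommGroup H] [NormedSpace ℝ H] {S : Set ℝ} (_ : MeasurableSet S)
    {A : ℝ → E →L[ℝ] E} (_ : Continuous A) {M : ℝ} (_ : ∀ t ∈ S, ‖A t‖ ≤ M)
    {c : ℝ → G →L[ℝ] H} (_ : Continuous c) {b : ℝ → ℝ} (_ : IntegrableOn b S)
    (_ : ∀ t ∈ S, ‖c t‖ ≤ b t) {F : E → G} (_ : ContDiff ℝ ∞ F),
    ContDiff ℝ n (fun p => ∫ t in S, c t (F (A t p))) := by
  induction n with
  | zero =>
    intro G H _ _ _ _ S hS A hA M hM c hc b hb hcb F hF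
    refine contDiff_zero.2 (continuous_iff_continuousAt.2 fun p => ?_)
    exact (hasFDerivAt_param hS hA hM hc hb hcb hF p).continuousAt
  | succ n ih =>
    intro G H _ _ _ _ S hS A hA M hM c hc b hb hcb F hF
    push_cast
    refine contDiff_succ_iff_hasFDerivAt.2
      ⟨_, ?_, fun p => hasFDerivAt_param hS hA hM hc hb hcb hF p⟩
    refine ih hS hA hM (c := derivCoeff A c) (by unfold derivCoeff; fun_prop)
      (hb.mul_const M) ?_ (hF.fderiv_right (by simp))
    intro t ht
    have hM0 := (norm_nonneg _).trans (hM t ht)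
    have hb0 := (norm_nonneg _).trans (hcb t ht)
    refine ContinuousLinearMap.opNorm_le_bound _ (mul_nonneg hb0 hM0) fun L => ?_
    have h2 : derivCoeff A c t L = (c t).comp (L.comp (A t)) := rfl
    rw [h2]
    refine (ContinuousLinearMap.opNorm_comp_le _ _).trans ?_
    calc ‖c t‖ * ‖L.comp (A t)‖ ≤ b t * (‖L‖ * M) := by
          refine mul_le_mul (hcb t ht) ((ContinuousLinearMap.opNorm_comp_le _ _).trans ?_)
            (norm_nonneg _) hb0
          exact mul_le_mul_of_nonneg_left (hM t ht) (norm_nonneg _)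
      _ = b t * M * ‖L‖ := by ring

theorem contDiff_param {S : Set ℝ} (hS : MeasurableSet S) {A : ℝ → E →L[ℝ] E}
    (hA : Continuous A) {M : ℝ} (hM : ∀ t ∈ S, ‖A t‖ ≤ M) {c : ℝ → G →L[ℝ] H}
    (hc : Continuous c) {b : ℝ → ℝ} (hb : IntegrableOn b S) (hcb : ∀ t ∈ S, ‖c t‖ ≤ b t)
    {F : E → G} (hF : ContDiff ℝ ∞ F) :
    ContDiff ℝ ∞ (fun p => ∫ t in S, c t (F (A t p))) :=
  contDiff_infty.2 fun n => contDiff_param_nat n hS hA hM hc hb hcb hF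

/-- Hadamard's lemma relative to a linear map `P`. -/
theorem exists_hadamard [CompleteSpace G] (P : E →L[ℝ] E) {F : E → G} (hF : ContDiff ℝ ∞ F) :
    ∃ B : E → E →L[ℝ] G, ContDiff ℝ ∞ B ∧ ∀ p, F p - F (P p) = B p (p - P p) := by
  -- The segment from `P` to the identity: `B p` is the average of the derivative of `F` between `P
  -- p` and `p`.
  set A : ℝ → E →L[ℝ] E := fun t => P + t • (ContinuousLinearMap.id ℝ E - P) with hAdef
  have hA : Continuous A := by fun_prop
  have hF' : ContDiff ℝ ∞ (fderiv ℝ F) := hF.fderiv_right (by simp)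
  obtain ⟨M, hM⟩ := (isCompact_Icc (a := (0 : ℝ)) (b := 1)).exists_bound_of_continuousOn
    hA.continuousOn
  have hM' : ∀ t ∈ Set.Ioc (0 : ℝ) 1, ‖A t‖ ≤ M := fun t ht => hM t ⟨ht.1.le, ht.2⟩
  refine ⟨fun p => ∫ t in Set.Ioc (0 : ℝ) 1, ContinuousLinearMap.id ℝ (E →L[ℝ] G)
    (fderiv ℝ F (A t p)), ?_, ?_⟩
  · refine contDiff_param measurableSet_Ioc hA hM'
      (b := fun _ => ‖ContinuousLinearMap.id ℝ (E →L[ℝ] G)‖) continuous_const ?_ ?_ hF'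
    · exact integrableOn_const (by simp)
    · intro t _
      exact le_rfl
  · intro p
    have hcont : Continuous fun t => fderiv ℝ F (A t p) :=
      hF'.continuous.comp (hA.clm_apply continuous_const)
    change _ = (∫ t in Set.Ioc (0 : ℝ) 1, fderiv ℝ F (A t p)) (p - P p)
    rw [ContinuousLinearMap.integral_apply (hcont.integrableOn_Ioc),
      ← intervalIntegral.integral_of_le zero_le_one]
    have hder (t : ℝ) : HasDerivAt (fun t => F (A t p)) (fderiv ℝ F (A t p) (p - P p)) t := by
      have h1 : HasDerivAt (fun t => A t p) (p - P p) t := by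
        have h2 : (fun t => A t p) = fun t => P p + t • (p - P p) := by
          funext t
          simp [hAdef]
        rw [h2]
        simpa using ((hasDerivAt_id t).smul_const (p - P p)).const_add (P p)
      exact ((hF.differentiable (by simp)) _).hasFDerivAt.comp_hasDerivAt t h1
    rw [intervalIntegral.integral_eq_sub_of_hasDerivAt (fun t _ => hder t)
      ((hcont.clm_apply continuous_const).intervalIntegrable _ _)]
    simp [hAdef]

end ParametricIntegral
end PoissonR3
end

noncomputable section
namespace PoissonR3
open MeasureTheory Filter Topology

/-! ### The contracting backward flow, and the equation V X - κX = F for Re κ < 0 -/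

section Flow

/-- The projection `(x, y, z) ↦ (x, y, 0)`. -/
def planeProj : Space →L[ℝ] Space :=
  ContinuousLinearMap.pi ![ContinuousLinearMap.proj 0, ContinuousLinearMap.proj 1, 0]

/-- The map `(x, y, z) ↦ (y, -x, 0)`. -/
def planeRot : Space →L[ℝ] Space :=
  ContinuousLinearMap.pi ![ContinuousLinearMap.proj 1, -ContinuousLinearMap.proj 0, 0]

/-- The linear map `(x, y, z) ↦ (τ x - y, x + τ y, 0)`, the vector field `τ E + T`. -/
def spiralField (τ : ℝ) : Space →L[ℝ] Space := τ • planeProj - planeRot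

/-- The backward flow of `τ E + T`, followed by the projection to the plane. -/
def spiralFlow (τ t : ℝ) : Space →L[ℝ] Space :=
  Real.exp (-τ * t) • (Real.cos t • planeProj + Real.sin t • planeRot)

@[simp] theorem planeProj_zero (p : Space) : planeProj p 0 = p 0 := rfl
@[simp] theorem planeProj_one (p : Space) : planeProj p 1 = p 1 := rfl
@[simp] theorem planeProj_two (p : Space) : planeProj p 2 = 0 := rfl
@[simp] theorem planeRot_zero (p : Space) : planeRot p 0 = p 1 := rfl
@[simp] theorem planeRot_one (p : Space) : planeRot p 1 = -p 0 := rfl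
@[simp] theorem planeRot_two (p : Space) : planeRot p 2 = 0 := rfl

theorem space_ext {p q : Space} (h0 : p 0 = q 0) (h1 : p 1 = q 1) (h2 : p 2 = q 2) : p = q := by
  funext i
  fin_cases i <;> assumption

theorem spiralFlow_zero (τ : ℝ) : spiralFlow τ 0 = planeProj := by
  simp [spiralFlow]

theorem spiralFlow_add (τ s t : ℝ) (p : Space) :
    spiralFlow τ t (spiralFlow τ s p) = spiralFlow τ (t + s) p := by
  have h : Real.exp (-(τ * (t + s))) = Real.exp (-(τ * t)) * Real.exp (-(τ * s)) := by
    rw [← Real.exp_add]; ring_nf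
  apply space_ext <;> simp [spiralFlow, h, Real.cos_add, Real.sin_add] <;> ring

theorem spiralFlow_planeProj (τ t : ℝ) (p : Space) :
    spiralFlow τ t (planeProj p) = spiralFlow τ t p := by
  simpa [spiralFlow_zero] using spiralFlow_add τ 0 t p

theorem planeProj_spiralField (τ : ℝ) (p : Space) :
    planeProj (spiralField τ p) = spiralField τ p := by
  apply space_ext <;> simp [spiralField]

theorem spiralField_planeProj (τ : ℝ) (p : Space) :
    spiralField τ (planeProj p) = spiralField τ p := by
  apply space_ext <;> simp [spiralField]

theorem continuous_spiralFlow (τ : ℝ) : Continuous (spiralFlow τ) := by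
  unfold spiralFlow
  fun_prop

theorem norm_spiralFlow_le (τ t : ℝ) :
    ‖spiralFlow τ t‖ ≤ Real.exp (-τ * t) * (‖planeProj‖ + ‖planeRot‖) := by
  rw [spiralFlow, norm_smul, Real.norm_of_nonneg (Real.exp_pos _).le]
  refine mul_le_mul_of_nonneg_left ((norm_add_le _ _).trans ?_) (Real.exp_pos _).le
  rw [norm_smul, norm_smul]
  exact add_le_add (mul_le_of_le_one_left (norm_nonneg _) (Real.abs_cos_le_one t))
    (mul_le_of_le_one_left (norm_nonneg _) (Real.abs_sin_le_one t))

theorem hasDerivAt_spiralFlow (τ t : ℝ) (p : Space) :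
    HasDerivAt (fun t => spiralFlow τ t p) (-spiralField τ (spiralFlow τ t p)) t := by
  have h1 : HasDerivAt (fun t => Real.exp (-τ * t)) (Real.exp (-τ * t) * -τ) t := by
    simpa using ((hasDerivAt_id t).const_mul (-τ)).exp
  have h2 : HasDerivAt (fun t => Real.cos t • planeProj p + Real.sin t • planeRot p)
      (-Real.sin t • planeProj p + Real.cos t • planeRot p) t :=
    ((Real.hasDerivAt_cos t).smul_const _).add ((Real.hasDerivAt_sin t).smul_const _)
  have h3 := h1.smul h2
  have h4 : -spiralField τ (spiralFlow τ t p) =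
      Real.exp (-τ * t) • (-Real.sin t • planeProj p + Real.cos t • planeRot p) +
      (Real.exp (-τ * t) * -τ) • (Real.cos t • planeProj p + Real.sin t • planeRot p) := by
    apply space_ext <;> simp [spiralFlow, spiralField] <;> ring
  rw [h4]
  exact h3

/-- Along the backward flow, `exp (κ t) X` has derivative `-exp (κ t) (V X - κ X)`. -/
theorem hasDerivAt_exp_mul_comp_flow (τ : ℝ) (κ : ℂ) {X : Space → ℂ} (hX : Differentiable ℝ X)
    (p : Space) (t : ℝ) :
    HasDerivAt (fun t : ℝ => Complex.exp (κ * t) * X (spiralFlow τ t p))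
      (-(Complex.exp (κ * t) * (fderiv ℝ X (spiralFlow τ t p)
        (spiralField τ (spiralFlow τ t p)) - κ * X (spiralFlow τ t p)))) t := by
  have h1 : HasDerivAt (fun t : ℝ => Complex.exp (κ * t)) (Complex.exp (κ * t) * κ) t := by
    have := ((hasDerivAt_id (t : ℂ)).const_mul κ).cexp.comp_ofReal
    simpa using this
  have h2 := (hX (spiralFlow τ t p)).hasFDerivAt.comp_hasDerivAt t (hasDerivAt_spiralFlow τ t p)
  refine (h1.mul h2).congr_deriv ?_
  rw [map_neg]
  simp only [Function.comp]
  ring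

/-- The equation `V X - κ X = F` in the plane, for `Re κ < 0`. -/
theorem exists_solution_of_re_neg {τ : ℝ} (hτ : 0 < τ) {κ : ℂ} (hκ : κ.re < 0) {F : Space → ℂ}
    (hF : ContDiff ℝ ∞ F) :
    ∃ X : Space → ℂ, ContDiff ℝ ∞ X ∧ (∀ p, X (planeProj p) = X p) ∧
      ∀ p, fderiv ℝ X p (spiralField τ p) - κ * X p = F (planeProj p) := by
  set c : ℝ → ℂ →L[ℝ] ℂ := fun t => ContinuousLinearMap.mul ℝ ℂ (Complex.exp (κ * t)) with hcdef
  have hc : Continuous c := by fun_prop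
  have hM : ∀ t ∈ Set.Ioi (0 : ℝ), ‖spiralFlow τ t‖ ≤ ‖planeProj‖ + ‖planeRot‖ := by
    intro t ht
    refine (norm_spiralFlow_le τ t).trans (mul_le_of_le_one_left (by positivity) ?_)
    rw [Real.exp_le_one_iff]
    nlinarith [Set.mem_Ioi.1 ht]
  have hb := integrableOn_exp_mul_Ioi hκ 0
  have hcb : ∀ t ∈ Set.Ioi (0 : ℝ), ‖c t‖ ≤ Real.exp (κ.re * t) := by
    intro t _
    simp [hcdef, Complex.norm_exp]
  have hint (p : Space) := integrable_param measurableSet_Ioi (continuous_spiralFlow τ) hM hc hb hcb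
    hF.continuous p
  set X : Space → ℂ := fun p => ∫ t in Set.Ioi (0 : ℝ), c t (F (spiralFlow τ t p)) with hXdef
  have hX : ContDiff ℝ ∞ X :=
    contDiff_param measurableSet_Ioi (continuous_spiralFlow τ) hM hc hb hcb hF
  have hXd : Differentiable ℝ X := hX.differentiable (by simp)
  have hXp : ∀ p, X (planeProj p) = X p := by
    intro p
    simp only [hXdef, spiralFlow_planeProj]
  refine ⟨X, hX, hXp, fun p => ?_⟩
  have hm : Continuous fun t => c t (F (spiralFlow τ t p)) :=
    hc.clm_apply (hF.continuous.comp ((continuous_spiralFlow τ).clm_apply continuous_const))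
  -- By the semigroup law, moving `p` along the flow shifts the integration variable. The left side
  -- can then be differentiated in `s` by the fundamental theorem of calculus, without
  -- differentiating inside the integral over the half-line.
  have hshift (s : ℝ) (hs : 0 ≤ s) : Complex.exp (κ * s) * X (spiralFlow τ s p) =
      X p - ∫ t in (0 : ℝ)..s, c t (F (spiralFlow τ t p)) := by
    have h1 : Complex.exp (κ * s) * X (spiralFlow τ s p) =
        ∫ t in Set.Ioi (0 : ℝ), c (t + s) (F (spiralFlow τ (t + s) p)) := by
      rw [hXdef, ← integral_const_mul]
      refine integral_congr_ae (Eventually.of_forall fun t => ?_)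
      simp only [hcdef, ContinuousLinearMap.mul_apply', spiralFlow_add]
      rw [← mul_assoc, ← Complex.exp_add]
      push_cast
      ring_nf
    have h2 := (measurePreserving_add_right volume s).setIntegral_preimage_emb
      (measurableEmbedding_addRight s) (fun t => c t (F (spiralFlow τ t p))) (Set.Ioi s)
    have h3 : (fun t : ℝ => t + s) ⁻¹' Set.Ioi s = Set.Ioi 0 := by
      ext t
      simp
    rw [h3] at h2
    rw [h1, h2]
    simp only [hXdef]
    rw [← intervalIntegral.integral_interval_add_Ioi (hint p)
      ((hint p).mono_set (Set.Ioi_subset_Ioi hs))]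
    simp
  -- The shift formula holds for `s ≥ 0` only, so the two computations of the derivative at 0 are
  -- compared from the right.
  have hd1 : HasDerivWithinAt (fun s : ℝ => Complex.exp (κ * s) * X (spiralFlow τ s p))
      (-(c 0 (F (spiralFlow τ 0 p)))) (Set.Ici 0) 0 := by
    have h1 : HasDerivAt (fun s => X p - ∫ t in (0 : ℝ)..s, c t (F (spiralFlow τ t p)))
        (-(c 0 (F (spiralFlow τ 0 p)))) 0 :=
      (intervalIntegral.integral_hasDerivAt_right (hm.intervalIntegrable _ _)
        (hm.stronglyMeasurableAtFilter _ _) hm.continuousAt).const_sub (X p)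
    exact h1.hasDerivWithinAt.congr (fun s hs => hshift s hs) (hshift 0 le_rfl)
  have hd2 := (hasDerivAt_exp_mul_comp_flow τ κ hXd p 0).hasDerivWithinAt (s := Set.Ici 0)
  have h := (uniqueDiffOn_Ici (0 : ℝ) 0 (by simp)).eq_deriv _ hd1 hd2
  -- The flow starts at `planeProj p`, not at `p`; independence of z moves the derivative back to
  -- `p`.
  have hcomp : fderiv ℝ X p (spiralField τ p) =
      fderiv ℝ X (planeProj p) (spiralField τ p) := by
    have h1 : HasFDerivAt (fun q => X (planeProj q)) _ p :=
      (hXd (planeProj p)).hasFDerivAt.comp p planeProj.hasFDerivAt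
    have h2 : (fun q => X (planeProj q)) = X := funext hXp
    rw [h2] at h1
    rw [h1.fderiv, ContinuousLinearMap.comp_apply, planeProj_spiralField]
  simp only [spiralFlow_zero, hXp, spiralField_planeProj, hcdef, Complex.ofReal_zero, mul_zero,
    Complex.exp_zero, one_mul, ContinuousLinearMap.mul_apply', neg_inj] at h
  rw [hcomp, h]

end Flow
end PoissonR3
end

noncomputable section
namespace PoissonR3
open MeasureTheory Filter Topology

/-! ### Kernel and cokernel of V - κ on complex functions in the plane -/

section SpiralEquation

/-- The complex coordinate `x + i y`. -/
def planeCoord : Space →L[ℝ] ℂ :=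
  Complex.ofRealCLM.comp (ContinuousLinearMap.proj 0) +
    Complex.I • Complex.ofRealCLM.comp (ContinuousLinearMap.proj 1)

/-- The eigenvalue `τ + i` of `τ E + T`. -/
def spiralEigen (τ : ℝ) : ℂ := τ + Complex.I

theorem planeCoord_apply (p : Space) : planeCoord p = p 0 + Complex.I * p 1 := rfl

theorem planeCoord_spiralField (τ : ℝ) (p : Space) :
    planeCoord (spiralField τ p) = spiralEigen τ * planeCoord p := by
  simp only [planeCoord_apply, spiralEigen, spiralField]
  simp
  linear_combination (-(p 1 : ℂ)) * Complex.I_sq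

/-- The conjugate coordinate `x - i y`. -/
def planeCoordConj : Space →L[ℝ] ℂ :=
  Complex.conjCLE.toContinuousLinearMap.comp planeCoord

theorem planeCoordConj_apply (p : Space) : planeCoordConj p = p 0 - Complex.I * p 1 := by
  change starRingEnd ℂ (p 0 + Complex.I * p 1) = _
  simp [sub_eq_add_neg]

theorem planeCoordConj_spiralField (τ : ℝ) (p : Space) :
    planeCoordConj (spiralField τ p) = starRingEnd ℂ (spiralEigen τ) * planeCoordConj p := by
  change starRingEnd ℂ (planeCoord (spiralField τ p)) = _ * starRingEnd ℂ (planeCoord p)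
  rw [planeCoord_spiralField, map_mul]

/-- Smooth solvability in the plane of `V X - κ X = F`, where `V = τ E + T`. -/
def SpiralSolvable (τ : ℝ) (κ : ℂ) (F : Space → ℂ) : Prop :=
  ∃ X : Space → ℂ, ContDiff ℝ ∞ X ∧ (∀ p, X (planeProj p) = X p) ∧
    ∀ p, fderiv ℝ X p (spiralField τ p) - κ * X p = F (planeProj p)

theorem SpiralSolvable.congr {τ : ℝ} {κ : ℂ} {F F' : Space → ℂ} (h : SpiralSolvable τ κ F)
    (hF : ∀ p, F (planeProj p) = F' (planeProj p)) : SpiralSolvable τ κ F' := by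
  obtain ⟨X, hX, hp, he⟩ := h
  exact ⟨X, hX, hp, fun p => (he p).trans (hF p)⟩

theorem SpiralSolvable.add {τ : ℝ} {κ : ℂ} {F F' : Space → ℂ} (h : SpiralSolvable τ κ F)
    (h' : SpiralSolvable τ κ F') : SpiralSolvable τ κ (fun p => F p + F' p) := by
  obtain ⟨X, hX, hp, he⟩ := h
  obtain ⟨X', hX', hp', he'⟩ := h'
  refine ⟨X + X', hX.add hX', fun p => by simp [hp, hp'], fun p => ?_⟩
  rw [fderiv_add (hX.differentiable (by simp) p) (hX'.differentiable (by simp) p)]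
  beta_reduce
  rw [← he p, ← he' p]
  simp
  ring

theorem SpiralSolvable.const {τ : ℝ} {κ : ℂ} (hκ : κ ≠ 0) (c : ℂ) :
    SpiralSolvable τ κ (fun _ => c) := by
  refine ⟨fun _ => -c / κ, contDiff_const, fun _ => rfl, fun p => ?_⟩
  simp
  field_simp

/-- Multiplying by an eigenfunction of `V` shifts `κ` by the eigenvalue. -/
theorem SpiralSolvable.mul_eigen {τ : ℝ} {κ μ : ℂ} {F : Space → ℂ} {ℓ : Space →L[ℝ] ℂ}
    (hℓ : ∀ p, ℓ (planeProj p) = ℓ p) (hμ : ∀ p, ℓ (spiralField τ p) = μ * ℓ p)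
    (h : SpiralSolvable τ (κ - μ) F) : SpiralSolvable τ κ (fun p => ℓ p * F p) := by
  obtain ⟨X, hX, hp, he⟩ := h
  refine ⟨fun p => ℓ p * X p, ℓ.contDiff.mul hX, fun p => by simp only [hℓ, hp], fun p => ?_⟩
  have h1 := (ℓ.hasFDerivAt (x := p)).mul (hX.differentiable (by simp) p).hasFDerivAt
  have h2 : fderiv ℝ (fun p => ℓ p * X p) p = _ := h1.fderiv
  rw [h2]
  beta_reduce
  rw [hℓ, ← he p]
  simp [hμ]
  ring

/-- Hadamard's lemma at the origin, expressed in ζ and its conjugate because these diagonalize V. -/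
theorem exists_complex_hadamard {F : Space → ℂ} (hF : ContDiff ℝ ∞ F) :
    ∃ α β : Space → ℂ, ContDiff ℝ ∞ α ∧ ContDiff ℝ ∞ β ∧ ∀ p, F (planeProj p) =
      F 0 + (planeCoord p * α (planeProj p) + planeCoordConj p * β (planeProj p)) := by
  obtain ⟨B, hB, h⟩ := exists_hadamard 0 hF
  have hBe (i : Fin 3) : ContDiff ℝ ∞ fun p => B p (Pi.single i 1) := hB.clm_apply contDiff_const
  -- From x u + y v = ζ (u - iv)/2 + ζ̄ (u + iv)/2.
  refine ⟨fun p => (B p (Pi.single 0 1) - Complex.I * B p (Pi.single 1 1)) / 2,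
    fun p => (B p (Pi.single 0 1) + Complex.I * B p (Pi.single 1 1)) / 2,
    ((hBe 0).sub (contDiff_const.mul (hBe 1))).div_const 2,
    ((hBe 0).add (contDiff_const.mul (hBe 1))).div_const 2, fun p => ?_⟩
  have h1 := h (planeProj p)
  have h2 : planeProj p = p 0 • Pi.single 0 (1 : ℝ) + p 1 • Pi.single 1 (1 : ℝ) := by
    apply space_ext <;> simp
  have h3 : B (planeProj p) (planeProj p) = p 0 * B (planeProj p) (Pi.single 0 1) +
      p 1 * B (planeProj p) (Pi.single 1 1) := by
    conv_lhs => rw [h2, map_add, map_smul, map_smul]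
    rw [← h2]
    simp
  rw [zero_apply, sub_zero, h3, sub_eq_iff_eq_add] at h1
  rw [h1, planeCoord_apply, planeCoordConj_apply]
  linear_combination (p 1 * B (planeProj p) (Pi.single 1 1)) * Complex.I_sq

theorem planeCoord_planeProj (p : Space) : planeCoord (planeProj p) = planeCoord p := rfl

theorem planeCoordConj_planeProj (p : Space) : planeCoordConj (planeProj p) = planeCoordConj p :=
  rfl

/-- Both Hadamard terms carry an eigenfunction factor whose eigenvalue has real part τ, so dividing
it out leaves an equation with Re κ = -τ < 0. -/
theorem spiralSolvable_of_re_zero {τ : ℝ} (hτ : 0 < τ) {κ : ℂ} (hκ : κ.re = 0) {F : Space → ℂ}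
    (hF : ContDiff ℝ ∞ F) (h0 : F 0 = 0) : SpiralSolvable τ κ F := by
  obtain ⟨α, β, hα, hβ, h⟩ := exists_complex_hadamard hF
  have h1 : SpiralSolvable τ κ fun p => planeCoord p * α p :=
    SpiralSolvable.mul_eigen planeCoord_planeProj (planeCoord_spiralField τ)
      (exists_solution_of_re_neg hτ (by simp [spiralEigen, hκ, hτ]) hα)
  have h2 : SpiralSolvable τ κ fun p => planeCoordConj p * β p :=
    SpiralSolvable.mul_eigen planeCoordConj_planeProj (planeCoordConj_spiralField τ)
      (exists_solution_of_re_neg hτ (by simp [spiralEigen, hκ, hτ]) hβ)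
  refine (h1.add h2).congr fun p => ?_
  rw [h, h0, zero_add, planeCoord_planeProj, planeCoordConj_planeProj]

theorem spiralEigen_ne_zero (τ : ℝ) : spiralEigen τ ≠ 0 := by
  intro h
  have := congrArg Complex.im h
  simp [spiralEigen] at this

/-- The cokernel of `V - (τ + i)` on smooth functions in the plane is spanned by `x + i y`. -/
theorem exists_spiralSolvable_eigen {τ : ℝ} (hτ : 0 < τ) {F : Space → ℂ} (hF : ContDiff ℝ ∞ F) :
    ∃ c : ℂ, SpiralSolvable τ (spiralEigen τ) (fun p => F p - c * planeCoord p) := by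
  obtain ⟨α, β, hα, hβ, h⟩ := exists_complex_hadamard hF
  -- Dividing by ζ lowers κ to 0, where only functions vanishing at the origin are reached; `α 0` is
  -- the obstruction and becomes the constant `c`.
  have h1 : SpiralSolvable τ (spiralEigen τ) fun p => planeCoord p * (α p - α 0) :=
    SpiralSolvable.mul_eigen planeCoord_planeProj (planeCoord_spiralField τ)
      (spiralSolvable_of_re_zero hτ (by simp) (hα.sub contDiff_const) (by simp))
  -- Dividing by the conjugate of ζ lowers κ to 2i. This is purely imaginary but nonzero, so the
  -- constant `β 0` is reached too and gives no obstruction.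
  have hre : (spiralEigen τ - starRingEnd ℂ (spiralEigen τ)).re = 0 := by simp
  have hne : spiralEigen τ - starRingEnd ℂ (spiralEigen τ) ≠ 0 := by
    intro h
    have := congrArg Complex.im h
    simp [spiralEigen] at this
  have h2 : SpiralSolvable τ (spiralEigen τ) fun p => planeCoordConj p * ((β p - β 0) + β 0) :=
    SpiralSolvable.mul_eigen planeCoordConj_planeProj (planeCoordConj_spiralField τ)
      ((spiralSolvable_of_re_zero hτ hre (hβ.sub contDiff_const) (by simp)).add
        (SpiralSolvable.const hne _))
  refine ⟨α 0, ((SpiralSolvable.const (spiralEigen_ne_zero τ) (F 0)).add (h1.add h2)).congr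
    fun p => ?_⟩
  rw [h, planeCoord_planeProj, planeCoordConj_planeProj]
  ring

/-- The derivative of the left side in `t` is a multiple of V X - κX, hence zero. -/
theorem exp_mul_comp_flow_eq {τ : ℝ} {κ : ℂ} {X : Space → ℂ} (hX : Differentiable ℝ X)
    (h : ∀ p, fderiv ℝ X p (spiralField τ p) = κ * X p) (p : Space) (t : ℝ) :
    Complex.exp (κ * t) * X (spiralFlow τ t p) = X (planeProj p) := by
  have hd (t : ℝ) := hasDerivAt_exp_mul_comp_flow τ κ hX p t
  simp only [h, sub_self, mul_zero, neg_zero] at hd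
  have := is_const_of_deriv_eq_zero (fun t => (hd t).differentiableAt) (fun t => (hd t).deriv) t 0
  simpa [spiralFlow_zero] using this

theorem tendsto_spiralFlow {τ : ℝ} (hτ : 0 < τ) (p : Space) :
    Tendsto (fun t => spiralFlow τ t p) atTop (𝓝 0) := by
  have h1 : Tendsto (fun t : ℝ => Real.exp (-τ * t) * (‖planeProj‖ + ‖planeRot‖) * ‖p‖) atTop
      (𝓝 0) := by
    have h2 : Tendsto (fun t : ℝ => Real.exp (-τ * t)) atTop (𝓝 0) :=
      Real.tendsto_exp_atBot.comp (tendsto_id.const_mul_atTop_of_neg (neg_neg_of_pos hτ))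
    simpa using (h2.mul_const (‖planeProj‖ + ‖planeRot‖)).mul_const ‖p‖
  refine squeeze_zero_norm (fun t => ?_) h1
  exact ((spiralFlow τ t).le_opNorm p).trans
    (mul_le_mul_of_nonneg_right (norm_spiralFlow_le τ t) (norm_nonneg _))

/-- Functions in the plane annihilated by `V` are constant. -/
theorem eq_const_of_spiral_invariant {τ : ℝ} (hτ : 0 < τ) {X : Space → ℂ}
    (hX : Differentiable ℝ X) (h : ∀ p, fderiv ℝ X p (spiralField τ p) = 0) (p : Space) :
    X (planeProj p) = X 0 := by
  have h1 (t : ℝ) : X (spiralFlow τ t p) = X (planeProj p) := by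
    simpa using exp_mul_comp_flow_eq (κ := 0) hX (by simpa using h) p t
  -- `X` is constant along the trajectory of `p`, which tends to the origin.
  have h2 := (hX.continuous.tendsto 0).comp (tendsto_spiralFlow hτ p)
  have h3 : (X ∘ fun t => spiralFlow τ t p) = fun _ => X (planeProj p) := funext h1
  rw [h3] at h2
  exact tendsto_nhds_unique tendsto_const_nhds h2

/-- The kernel of `V - (τ + i)` on smooth functions in the plane is spanned by `x + i y`. -/
theorem exists_eq_mul_planeCoord {τ : ℝ} (hτ : 0 < τ) {X : Space → ℂ}
    (hX : Differentiable ℝ X) (hXp : ∀ p, X (planeProj p) = X p)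
    (h : ∀ p, fderiv ℝ X p (spiralField τ p) = spiralEigen τ * X p) :
    ∃ c : ℂ, ∀ p, X p = c * planeCoord p := by
  have h0 : X 0 = 0 := by
    have := h 0
    rw [map_zero, map_zero] at this
    exact (mul_eq_zero.1 this.symm).resolve_left (spiralEigen_ne_zero τ)
  have hlin (p : Space) : X p = fderiv ℝ X 0 (planeProj p) := by
    -- At the times 2πn the rotation is trivial and the flow is a pure scaling by e^{-2πnτ}. The
    -- difference quotients of `X` at 0 in the direction of `p` along these scales therefore all
    -- equal `X p`, and their limit is the derivative at 0: `X` is linear.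
    have h1 (n : ℕ) : Real.exp (τ * (n * (2 * Real.pi))) •
        (X (0 + (Real.exp (τ * (n * (2 * Real.pi))))⁻¹ • planeProj p) - X 0) = X p := by
      have h2 := exp_mul_comp_flow_eq hX h p (n * (2 * Real.pi))
      have h3 : spiralFlow τ (n * (2 * Real.pi)) p =
          (Real.exp (τ * (n * (2 * Real.pi))))⁻¹ • planeProj p := by
        have h5 : Real.sin (n * (2 * Real.pi)) = 0 := by
          simpa using Real.sin_add_nat_mul_two_pi 0 n
        simp [spiralFlow, Real.exp_neg, h5]
      have h4 : Complex.exp (spiralEigen τ * ((n * (2 * Real.pi) : ℝ) : ℂ)) =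
          (Real.exp (τ * (n * (2 * Real.pi))) : ℝ) := by
        have h5 : spiralEigen τ * ((n * (2 * Real.pi) : ℝ) : ℂ) =
            ((τ * (n * (2 * Real.pi)) : ℝ) : ℂ) + n * (2 * Real.pi * Complex.I) := by
          simp only [spiralEigen]
          push_cast
          ring
        rw [h5, Complex.exp_add, Complex.exp_nat_mul_two_pi_mul_I, mul_one, Complex.ofReal_exp]
      rw [h0, sub_zero, zero_add, ← h3, Complex.real_smul, ← h4, h2, hXp]
    have h2 : Tendsto (fun n : ℕ => ‖Real.exp (τ * (n * (2 * Real.pi)))‖) atTop atTop := by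
      simp only [Real.norm_eq_abs, Real.abs_exp]
      refine Real.tendsto_exp_atTop.comp (Tendsto.const_mul_atTop hτ ?_)
      exact tendsto_natCast_atTop_atTop.atTop_mul_const (by positivity)
    have h3 := (hX 0).hasFDerivAt.lim (planeProj p) h2
    simp only [h1] at h3
    exact tendsto_nhds_unique tendsto_const_nhds h3
  set L := fderiv ℝ X 0
  have hL (p : Space) : X p = p 0 * L (Pi.single 0 1) + p 1 * L (Pi.single 1 1) := by
    have h2 : planeProj p = p 0 • Pi.single 0 (1 : ℝ) + p 1 • Pi.single 1 (1 : ℝ) := by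
      apply space_ext <;> simp
    rw [hlin, h2, map_add, map_smul, map_smul]
    simp
  have hX' : X = fun p => L (planeProj p) := funext hlin
  have hder : fderiv ℝ X (Pi.single 0 1) = L.comp planeProj := by
    conv_lhs => rw [hX']
    exact (L.comp planeProj).fderiv
  -- For linear `X`, the eigenvalue equation at (1, 0, 0) says L(∂_y) = i L(∂_x), so `X` is complex
  -- linear in ζ.
  have h1 := h (Pi.single 0 1)
  rw [hder, ContinuousLinearMap.comp_apply, ← hlin, hL, hL] at h1
  simp [spiralField, spiralEigen] at h1
  refine ⟨L (Pi.single 0 1), fun p => ?_⟩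
  rw [hL, planeCoord_apply]
  linear_combination (p 1 : ℂ) * h1

end SpiralEquation
end PoissonR3
end

noncomputable section
namespace PoissonR3
open MeasureTheory Filter Topology

/-! ### Real smooth functions: z-primitives, division by V, and the planar equations -/

section SmoothFunctions

theorem SmoothFun.ext {f g : SmoothFun} (h : ∀ p, f.1 p = g.1 p) : f = g :=
  Subtype.ext (funext h)

@[simp] theorem SmoothFun.add_val (f g : SmoothFun) (p : Space) : (f + g).1 p = f.1 p + g.1 p := rfl
@[simp] theorem SmoothFun.sub_val (f g : SmoothFun) (p : Space) : (f - g).1 p = f.1 p - g.1 p := rfl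
@[simp] theorem SmoothFun.neg_val (f : SmoothFun) (p : Space) : (-f).1 p = -f.1 p := rfl
@[simp] theorem SmoothFun.mul_val (f g : SmoothFun) (p : Space) : (f * g).1 p = f.1 p * g.1 p := rfl
@[simp] theorem SmoothFun.zero_val (p : Space) : (0 : SmoothFun).1 p = 0 := rfl
@[simp] theorem SmoothFun.one_val (p : Space) : (1 : SmoothFun).1 p = 1 := rfl

/-- The constant function `c`. -/
def constFun (c : ℝ) : SmoothFun := algebraMap ℝ SmoothFun c

@[simp] theorem constFun_val (c : ℝ) (p : Space) : (constFun c).1 p = c := rfl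
@[simp] theorem coord_val (i : Fin 3) (p : Space) : (coord i).1 p = p i := rfl

@[simp] theorem pderiv_constFun (i : Fin 3) (c : ℝ) : pderiv i (constFun c) = 0 := by
  refine SmoothFun.ext fun p => ?_
  change fderiv ℝ (fun _ : Space => c) p _ = 0
  simp

theorem pderiv_coord (i j : Fin 3) : pderiv i (coord j) = if i = j then 1 else 0 := by
  refine SmoothFun.ext fun p => ?_
  change fderiv ℝ (ContinuousLinearMap.proj j : Space →L[ℝ] ℝ) p _ = _
  rw [ContinuousLinearMap.fderiv]
  by_cases h : i = j
  · subst h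
    simp
  · simp [h, Ne.symm h]

theorem pderiv_comm (i j : Fin 3) (f : SmoothFun) : pderiv i (pderiv j f) = pderiv j (pderiv i f) := by
  refine SmoothFun.ext fun p => ?_
  have h2 : ContDiff ℝ ∞ (fderiv ℝ f.1) := (mem_smoothFun.1 f.2).fderiv_right (by simp)
  have hd : DifferentiableAt ℝ (fderiv ℝ f.1) p := h2.differentiable (by simp) p
  have h (i j : Fin 3) : (pderiv i (pderiv j f)).1 p =
      fderiv ℝ (fderiv ℝ f.1) p (Pi.single i 1) (Pi.single j 1) := by
    change fderiv ℝ (fun q => fderiv ℝ f.1 q (Pi.single j 1)) p (Pi.single i 1) = _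
    rw [fderiv_clm_apply hd (differentiableAt_const _)]
    simp
  rw [h, h]
  exact ((mem_smoothFun.1 f.2).contDiffAt.isSymmSndFDerivAt (by
    rw [minSmoothness_of_isRCLikeNormedField]
    exact WithTop.coe_le_coe.2 (le_top : (2 : ℕ∞) ≤ ⊤))) _ _

theorem fderiv_eq_pderiv (f : SmoothFun) (p v : Space) :
    fderiv ℝ f.1 p v = v 0 * (pderiv 0 f).1 p + v 1 * (pderiv 1 f).1 p + v 2 * (pderiv 2 f).1 p := by
  have h : v = v 0 • Pi.single 0 (1 : ℝ) + v 1 • Pi.single 1 (1 : ℝ) + v 2 • Pi.single 2 (1 : ℝ) := by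
    apply space_ext <;> simp
  conv_lhs => rw [h]
  rw [map_add, map_add, map_smul, map_smul, map_smul]
  rfl

/-- The first component `τ x - y` of `τ E + T`. -/
def spiralX (τ : ℝ) : SmoothFun := constFun τ * coord 0 - coord 1

/-- The second component `x + τ y` of `τ E + T`. -/
def spiralY (τ : ℝ) : SmoothFun := coord 0 + constFun τ * coord 1

/-- The derivation `τ E + T` of `C^∞(ℝ³)`. -/
def spiralDeriv (τ : ℝ) (f : SmoothFun) : SmoothFun :=
  spiralX τ * pderiv 0 f + spiralY τ * pderiv 1 f

theorem spiralDeriv_val (τ : ℝ) (f : SmoothFun) (p : Space) :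
    (spiralDeriv τ f).1 p = fderiv ℝ f.1 p (spiralField τ p) := by
  rw [fderiv_eq_pderiv]
  simp [spiralDeriv, spiralX, spiralY, spiralField]
  left
  ring

@[simp] theorem pderiv_zero_spiralX (τ : ℝ) : pderiv 0 (spiralX τ) = constFun τ := by
  simp [spiralX, pderiv_mul, pderiv_coord]
@[simp] theorem pderiv_one_spiralX (τ : ℝ) : pderiv 1 (spiralX τ) = -1 := by
  simp [spiralX, pderiv_mul, pderiv_coord]
@[simp] theorem pderiv_two_spiralX (τ : ℝ) : pderiv 2 (spiralX τ) = 0 := by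
  simp [spiralX, pderiv_mul, pderiv_coord]
@[simp] theorem pderiv_zero_spiralY (τ : ℝ) : pderiv 0 (spiralY τ) = 1 := by
  simp [spiralY, pderiv_mul, pderiv_coord]
@[simp] theorem pderiv_one_spiralY (τ : ℝ) : pderiv 1 (spiralY τ) = constFun τ := by
  simp [spiralY, pderiv_mul, pderiv_coord]
@[simp] theorem pderiv_two_spiralY (τ : ℝ) : pderiv 2 (spiralY τ) = 0 := by
  simp [spiralY, pderiv_mul, pderiv_coord]

/-- Functions of `(x, y)` only. -/
theorem pderiv_two_eq_zero_iff (f : SmoothFun) :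
    pderiv 2 f = 0 ↔ ∀ p, f.1 (planeProj p) = f.1 p := by
  constructor
  · intro h p
    have hd (s : ℝ) : HasDerivAt (fun s : ℝ => f.1 (planeProj p + s • (Pi.single 2 1 : Space))) 0 s := by
      have h1 : HasDerivAt (fun s : ℝ => planeProj p + s • (Pi.single 2 1 : Space))
          (Pi.single 2 1 : Space) s := by
        simpa using ((hasDerivAt_id s).smul_const (Pi.single 2 1 : Space)).const_add (planeProj p)
      have h2 := ((smooth_differentiable f) (planeProj p + s • (Pi.single 2 1 : Space))).hasFDerivAt
        |>.comp_hasDerivAt s h1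
      refine h2.congr_deriv ?_
      exact congrArg (fun g : SmoothFun => g.1 (planeProj p + s • (Pi.single 2 1 : Space))) h
    have h3 := is_const_of_deriv_eq_zero (fun t => (hd t).differentiableAt)
      (fun t => (hd t).deriv) 0 (p 2)
    have h4 : planeProj p + p 2 • Pi.single 2 (1 : ℝ) = p := by
      apply space_ext <;> simp
    simpa [h4] using h3
  · intro h
    refine SmoothFun.ext fun p => ?_
    have h1 : HasFDerivAt (fun q => f.1 (planeProj q)) _ p :=
      ((smooth_differentiable f) (planeProj p)).hasFDerivAt.comp p planeProj.hasFDerivAt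
    have h2 : (fun q => f.1 (planeProj q)) = f.1 := funext h
    rw [h2] at h1
    change fderiv ℝ f.1 p (Pi.single 2 1) = 0
    have h3 : planeProj (Pi.single 2 (1 : ℝ)) = 0 := by
      apply space_ext <;> simp
    rw [h1.fderiv, ContinuousLinearMap.comp_apply, h3, map_zero]

/-- Smooth functions have smooth primitives in the variable `z`. -/
theorem exists_pderiv_two_eq (h : SmoothFun) : ∃ f : SmoothFun, pderiv 2 f = h := by
  set A : ℝ → Space →L[ℝ] Space :=
    fun t => planeProj + t • (ContinuousLinearMap.id ℝ Space - planeProj) with hAdef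
  have hA : Continuous A := by fun_prop
  obtain ⟨M, hM⟩ := (isCompact_Icc (a := (0 : ℝ)) (b := 1)).exists_bound_of_continuousOn
    hA.continuousOn
  have hK : ContDiff ℝ ∞ fun p => ∫ t in Set.Ioc (0 : ℝ) 1,
      ContinuousLinearMap.id ℝ ℝ (h.1 (A t p)) :=
    contDiff_param measurableSet_Ioc hA (fun t ht => hM t ⟨ht.1.le, ht.2⟩)
      (b := fun _ => ‖ContinuousLinearMap.id ℝ ℝ‖) continuous_const
      (integrableOn_const (by simp)) (fun _ _ => le_rfl) (mem_smoothFun.1 h.2)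
  -- The primitive is written as z ∫₀¹ h(x, y, tz) dt: fixed limits and linear maps `A t` give
  -- smoothness by `contDiff_param`. On vertical lines it becomes the usual integral from 0 to z.
  refine ⟨coord 2 * ⟨_, mem_smoothFun.2 hK⟩, SmoothFun.ext fun p => ?_⟩
  set f : SmoothFun := coord 2 * ⟨_, mem_smoothFun.2 hK⟩ with hf
  set ℓ : ℝ → Space := fun s => planeProj p + s • (Pi.single 2 1 : Space) with hℓ
  have hA' (s t : ℝ) : A t (ℓ s) = ℓ (s * t) := by
    apply space_ext <;> simp [hAdef, hℓ] ; ring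
  have hline (s : ℝ) : f.1 (ℓ s) = ∫ t in (0 : ℝ)..s, h.1 (ℓ t) := by
    have h1 := intervalIntegral.mul_integral_comp_mul_left (a := 0) (b := 1)
      (f := fun t => h.1 (ℓ t)) s
    rw [mul_zero, mul_one] at h1
    rw [← h1, intervalIntegral.integral_of_le zero_le_one]
    simp only [← hA']
    rw [hf, SmoothFun.mul_val]
    congr 1
    simp [hℓ]
  have hℓd : HasDerivAt ℓ (Pi.single 2 1 : Space) (p 2) :=
    (((hasDerivAt_id (p 2)).smul_const (Pi.single 2 1 : Space)).const_add
      (planeProj p)).congr_deriv (one_smul _ _)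
  have hℓp : ℓ (p 2) = p := by
    apply space_ext <;> simp [hℓ]
  have hcont : Continuous fun t => h.1 (ℓ t) := (mem_smoothFun.1 h.2).continuous.comp (by fun_prop)
  have hd1 : HasDerivAt (fun s => f.1 (ℓ s)) (h.1 (ℓ (p 2))) (p 2) := by
    simp only [hline]
    exact intervalIntegral.integral_hasDerivAt_right (hcont.intervalIntegrable _ _)
      (hcont.stronglyMeasurableAtFilter _ _) hcont.continuousAt
  have hd2 := ((smooth_differentiable f) (ℓ (p 2))).hasFDerivAt.comp_hasDerivAt (p 2) hℓd
  have := hd2.unique hd1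
  rw [hℓp] at this
  exact this

/-- The affine factor vanishes at a single point, whose complement is dense. -/
theorem eq_zero_of_affine_mul {φ : ℝ → ℝ} (hφ : Continuous φ) {a c : ℝ} (hc : c ≠ 0)
    (h : ∀ s, (a + s * c) * φ s = 0) : φ 0 = 0 := by
  have h1 : Set.EqOn φ 0 {-a / c}ᶜ := by
    intro s hs
    refine (mul_eq_zero.1 (h s)).resolve_left fun h2 => hs ?_
    rw [Set.mem_singleton_iff]
    field_simp
    linarith
  exact congrFun (hφ.ext_on (dense_compl_singleton _) continuous_zero h1) 0

/-- If `v f` vanishes on a line along which the linear function `v` is not constant, then so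
does `f`. -/
theorem eq_zero_of_mul_eq_zero_line {v f : SmoothFun} {p m : Space} {c : ℝ} (hc : c ≠ 0)
    (hv : ∀ s : ℝ, v.1 (p + s • m) = v.1 p + s * c)
    (h : ∀ s : ℝ, v.1 (p + s • m) * f.1 (p + s • m) = 0) : f.1 p = 0 := by
  have h1 := eq_zero_of_affine_mul (φ := fun s => f.1 (p + s • m))
    ((mem_smoothFun.1 f.2).continuous.comp (by fun_prop)) hc (fun s => by rw [← hv]; exact h s)
  simpa using h1

theorem spiralX_add_smul (τ : ℝ) (p m : Space) (s : ℝ) :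
    (spiralX τ).1 (p + s • m) = (spiralX τ).1 p + s * (spiralX τ).1 m := by
  simp [spiralX]
  ring

theorem spiralY_add_smul (τ : ℝ) (p m : Space) (s : ℝ) :
    (spiralY τ).1 (p + s • m) = (spiralY τ).1 p + s * (spiralY τ).1 m := by
  simp [spiralY]
  ring

/-- `spiralX τ` has slope -1 along ∂_y, so it is not a zero divisor. -/
theorem eq_zero_of_spiralX_mul {τ : ℝ} {f : SmoothFun} (h : spiralX τ * f = 0) : f = 0 := by
  refine SmoothFun.ext fun p => ?_
  refine eq_zero_of_mul_eq_zero_line (v := spiralX τ) (m := ![0, 1, 0]) (c := -1) (by simp)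
    (fun s => ?_) fun s => congrArg (fun g : SmoothFun => g.1 (p + s • ![0, 1, 0])) h
  rw [spiralX_add_smul]
  simp [spiralX]

/-- Division by the vector field `τ E + T`. -/
theorem exists_eq_spiral_mul {τ : ℝ} {a b : SmoothFun} (h : spiralX τ * b = spiralY τ * a) :
    ∃ k : SmoothFun, a = spiralX τ * k ∧ b = spiralY τ * k := by
  have hτ : τ ^ 2 + 1 ≠ 0 := by positivity
  set u : Space →L[ℝ] ℝ := τ • ContinuousLinearMap.proj 0 - ContinuousLinearMap.proj 1 with hu
  have hu' (p : Space) : u p = τ * p 0 - p 1 := rfl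
  -- Normalized so that `u n = 1`: then `P` is the projection along `n` onto the plane where
  -- `spiralX τ` vanishes.
  set n : Space := ![τ / (τ ^ 2 + 1), -1 / (τ ^ 2 + 1), 0] with hn
  set P : Space →L[ℝ] Space := ContinuousLinearMap.id ℝ Space - u.smulRight n with hP
  have hPp (p : Space) : p - P p = (spiralX τ).1 p • n := by
    simp [hP, spiralX, hu']
  obtain ⟨B, hB, hBa⟩ := exists_hadamard P (mem_smoothFun.1 a.2)
  have haP (p : Space) : a.1 (P p) = 0 := by
    -- The direction (1, τ, 0) stays in that plane. There the hypothesis reduces to `spiralY τ * a =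
    -- 0`, while `spiralY τ` has slope 1 + τ² along this direction. So `a` vanishes on the plane and
    -- Hadamard's lemma divides it by `spiralX τ`.
    refine eq_zero_of_mul_eq_zero_line (v := spiralY τ) (m := ![1, τ, 0]) (c := 1 + τ ^ 2)
      (by positivity) (fun s => ?_) fun s => ?_
    · rw [spiralY_add_smul]
      simp [spiralY]
      left
      ring
    · have h1 := congrArg (fun g : SmoothFun => g.1 (P p + s • ![1, τ, 0])) h
      simp only [SmoothFun.mul_val] at h1
      rw [← h1, spiralX_add_smul]
      have h2 : (spiralX τ).1 (P p) = 0 := by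
        have h3 : (spiralX τ).1 (P p) = τ * (p 0 - u p * (τ / (τ ^ 2 + 1))) -
            (p 1 - u p * (-1 / (τ ^ 2 + 1))) := rfl
        rw [h3, hu']
        field_simp
        ring
      rw [h2]
      simp [spiralX]
  set k : SmoothFun := ⟨fun p => B p n, mem_smoothFun.2 (hB.clm_apply contDiff_const)⟩ with hk
  have ha : a = spiralX τ * k := by
    refine SmoothFun.ext fun p => ?_
    have := hBa p
    rw [haP, sub_zero, hPp, map_smul] at this
    exact this
  refine ⟨k, ha, ?_⟩
  have h3 : spiralX τ * (b - spiralY τ * k) = 0 := by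
    rw [mul_sub, h]
    nth_rewrite 1 [ha]
    ring
  exact sub_eq_zero.1 (eq_zero_of_spiralX_mul h3)

/-- The real part of a smooth complex function. -/
def reFun (X : Space → ℂ) (hX : ContDiff ℝ ∞ X) : SmoothFun :=
  ⟨fun p => (X p).re, mem_smoothFun.2 (Complex.reCLM.contDiff.comp hX)⟩

/-- The imaginary part of a smooth complex function. -/
def imFun (X : Space → ℂ) (hX : ContDiff ℝ ∞ X) : SmoothFun :=
  ⟨fun p => (X p).im, mem_smoothFun.2 (Complex.imCLM.contDiff.comp hX)⟩

theorem spiralDeriv_reFun (τ : ℝ) {X : Space → ℂ} (hX : ContDiff ℝ ∞ X) (p : Space) :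
    (spiralDeriv τ (reFun X hX)).1 p = (fderiv ℝ X p (spiralField τ p)).re := by
  rw [spiralDeriv_val]
  have h : HasFDerivAt (fun p => (X p).re) _ p :=
    Complex.reCLM.hasFDerivAt.comp p (hX.differentiable (by simp) p).hasFDerivAt
  change fderiv ℝ (fun p => (X p).re) p _ = _
  rw [h.fderiv]
  rfl

theorem spiralDeriv_imFun (τ : ℝ) {X : Space → ℂ} (hX : ContDiff ℝ ∞ X) (p : Space) :
    (spiralDeriv τ (imFun X hX)).1 p = (fderiv ℝ X p (spiralField τ p)).im := by
  rw [spiralDeriv_val]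
  have h : HasFDerivAt (fun p => (X p).im) _ p :=
    Complex.imCLM.hasFDerivAt.comp p (hX.differentiable (by simp) p).hasFDerivAt
  change fderiv ℝ (fun p => (X p).im) p _ = _
  rw [h.fderiv]
  rfl

/-- The complex function `a + i b`. -/
def complexFun (a b : SmoothFun) (p : Space) : ℂ := a.1 p + b.1 p * Complex.I

theorem contDiff_complexFun (a b : SmoothFun) : ContDiff ℝ ∞ (complexFun a b) :=
  (Complex.ofRealCLM.contDiff.comp (mem_smoothFun.1 a.2)).add
    ((Complex.ofRealCLM.contDiff.comp (mem_smoothFun.1 b.2)).mul contDiff_const)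

theorem fderiv_complexFun (τ : ℝ) (a b : SmoothFun) (p : Space) :
    fderiv ℝ (complexFun a b) p (spiralField τ p) =
      complexFun (spiralDeriv τ a) (spiralDeriv τ b) p := by
  have h1 := spiralDeriv_reFun τ (contDiff_complexFun a b) p
  have h2 := spiralDeriv_imFun τ (contDiff_complexFun a b) p
  have h3 : reFun _ (contDiff_complexFun a b) = a := SmoothFun.ext fun p => by
    simp [reFun, complexFun]
  have h4 : imFun _ (contDiff_complexFun a b) = b := SmoothFun.ext fun p => by
    simp [imFun, complexFun]
  rw [h3] at h1
  rw [h4] at h2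
  apply Complex.ext <;> simp [complexFun, ← h1, ← h2]

/-- In the plane, functions vanishing at the origin are in the image of `τ E + T`. -/
theorem exists_spiralDeriv_eq {τ : ℝ} (hτ : 0 < τ) {g : SmoothFun} (hg : pderiv 2 g = 0)
    (h0 : g.1 0 = 0) : ∃ f : SmoothFun, pderiv 2 f = 0 ∧ spiralDeriv τ f = g := by
  obtain ⟨X, hX, hXp, h⟩ := spiralSolvable_of_re_zero (κ := 0) hτ rfl (contDiff_complexFun g 0)
    (by simp [complexFun, h0])
  refine ⟨reFun X hX, (pderiv_two_eq_zero_iff _).2 fun p => congrArg Complex.re (hXp p),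
    SmoothFun.ext fun p => ?_⟩
  have h1 := h p
  rw [zero_mul, sub_zero] at h1
  rw [spiralDeriv_reFun, h1]
  simp [complexFun, (pderiv_two_eq_zero_iff g).1 hg]

theorem planar_const_of_spiralDeriv_eq_zero {τ : ℝ} (hτ : 0 < τ) {f : SmoothFun}
    (hf : pderiv 2 f = 0) (h : spiralDeriv τ f = 0) : f = constFun (f.1 0) := by
  refine SmoothFun.ext fun p => ?_
  have h1 := eq_const_of_spiral_invariant hτ (X := complexFun f 0)
    ((contDiff_complexFun f 0).differentiable (by simp)) (fun p => by
      rw [fderiv_complexFun, h]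
      simp [complexFun, spiralDeriv]) p
  simpa [complexFun, (pderiv_two_eq_zero_iff f).1 hf] using h1

/-- The commutant of `τ E + T` among vector fields in the plane is spanned by `E` and
`τ E + T`. -/
theorem exists_of_spiral_commute {τ : ℝ} (hτ : 0 < τ) {a b : SmoothFun}
    (ha : pderiv 2 a = 0) (hb : pderiv 2 b = 0)
    (h1 : spiralDeriv τ a - constFun τ * a + b = 0)
    (h2 : spiralDeriv τ b - a - constFun τ * b = 0) :
    ∃ c m : ℝ, a = constFun c * coord 0 + constFun m * spiralX τ ∧
      b = constFun c * coord 1 + constFun m * spiralY τ := by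
  -- The hypotheses are the real and imaginary parts of V X = (τ + i) X for X = a + ib.
  obtain ⟨c, hc⟩ := exists_eq_mul_planeCoord hτ (X := complexFun a b)
    ((contDiff_complexFun a b).differentiable (by simp))
    (fun p => by
      simp only [complexFun, (pderiv_two_eq_zero_iff a).1 ha, (pderiv_two_eq_zero_iff b).1 hb])
    (fun p => by
      have h3 := congrArg (fun g : SmoothFun => g.1 p) h1
      have h4 := congrArg (fun g : SmoothFun => g.1 p) h2
      rw [fderiv_complexFun]
      simp at h3 h4
      apply Complex.ext <;> simp [complexFun, spiralEigen] <;> linarith)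
  -- As a vector field, cζ is Re(c) E + Im(c) T, and T = V - τE.
  refine ⟨c.re - c.im * τ, c.im, SmoothFun.ext fun p => ?_, SmoothFun.ext fun p => ?_⟩
  · have := congrArg Complex.re (hc p)
    simp [complexFun, planeCoord_apply] at this
    simp [spiralX, this]
    ring
  · have := congrArg Complex.im (hc p)
    simp [complexFun, planeCoord_apply] at this
    simp [spiralY, this]
    ring

/-- In the plane, the cokernel of the bracket with `τ E + T` is spanned by `E` and
`τ E + T`. -/
theorem exists_spiral_bracket_eq {τ : ℝ} (hτ : 0 < τ) {α β : SmoothFun}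
    (hα : pderiv 2 α = 0) (hβ : pderiv 2 β = 0) :
    ∃ (a b : SmoothFun) (c m : ℝ), pderiv 2 a = 0 ∧ pderiv 2 b = 0 ∧
      α = spiralDeriv τ a - constFun τ * a + b + constFun c * coord 0 + constFun m * spiralX τ ∧
      β = spiralDeriv τ b - a - constFun τ * b + constFun c * coord 1 + constFun m * spiralY τ := by
  obtain ⟨c, X, hX, hXp, h⟩ := exists_spiralSolvable_eigen hτ (contDiff_complexFun α β)
  refine ⟨reFun X hX, imFun X hX, c.re - c.im * τ, c.im,
    (pderiv_two_eq_zero_iff _).2 fun p => congrArg Complex.re (hXp p),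
    (pderiv_two_eq_zero_iff _).2 fun p => congrArg Complex.im (hXp p),
    SmoothFun.ext fun p => ?_, SmoothFun.ext fun p => ?_⟩
  · have := congrArg Complex.re (h p)
    simp [complexFun, planeCoord_apply, spiralEigen, (pderiv_two_eq_zero_iff α).1 hα] at this
    simp only [SmoothFun.add_val, SmoothFun.sub_val, SmoothFun.mul_val, spiralDeriv_reFun]
    simp [spiralX, reFun, imFun]
    linarith
  · have := congrArg Complex.im (h p)
    simp [complexFun, planeCoord_apply, spiralEigen, (pderiv_two_eq_zero_iff β).1 hβ] at this
    simp only [SmoothFun.add_val, SmoothFun.sub_val, SmoothFun.mul_val, spiralDeriv_imFun]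
    simp [spiralY, reFun, imFun]
    linarith

end SmoothFunctions
end PoissonR3
end

noncomputable section
namespace PoissonR3

/-! ### Contractions, degrees, and the degree of the bracket -/

section Grading

theorem partialVec_eq (i : Fin 3) :
    partialVec i = (1 : SmoothFun) ⊗ₜ[ℝ] ExteriorAlgebra.ι ℝ (Pi.single i (1 : ℝ) : Space) := rfl

theorem partialVec_mul_self (i : Fin 3) : partialVec i * partialVec i = 0 := by
  simp [partialVec_eq]

theorem partialVec_mul_swap (i j : Fin 3) :
    partialVec i * partialVec j = -(partialVec j * partialVec i) := by
  rw [eq_neg_iff_add_eq_zero]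
  simp only [partialVec_eq, Algebra.TensorProduct.tmul_mul_tmul, ← TensorProduct.tmul_add,
    ExteriorAlgebra.ι_add_mul_swap, TensorProduct.tmul_zero]

theorem contrL_partialVec_mul (i j : Fin 3) (P : MultiVec) :
    contrL i (partialVec j * P) = (if i = j then P else 0) - partialVec j * contrL i P := by
  induction P using TensorProduct.induction_on with
  | zero => simp
  | tmul g w =>
    have h := CliffordAlgebra.contractLeft_ι_mul (Q := (0 : QuadraticForm ℝ Space))
      (LinearMap.proj i : Module.Dual ℝ Space) (Pi.single j 1) w
    simp only [partialVec_eq, contrL, Algebra.TensorProduct.tmul_mul_tmul,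
      LinearMap.baseChange_tmul, one_mul]
    erw [h]
    rw [TensorProduct.tmul_sub]
    congr 1
    by_cases hij : i = j
    · subst hij
      simp
    · simp [hij]
  | add P Q hP hQ =>
    rw [mul_add, map_add, hP, hQ, map_add, mul_add]
    split_ifs <;> abel

theorem contrR_mul_partialVec (i j : Fin 3) (P : MultiVec) :
    contrR i (P * partialVec j) = (if i = j then P else 0) - contrR i P * partialVec j := by
  induction P using TensorProduct.induction_on with
  | zero => simp
  | tmul g w =>
    have h := CliffordAlgebra.contractRight_mul_ι (Q := (0 : QuadraticForm ℝ Space))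
      (LinearMap.proj i : Module.Dual ℝ Space) (Pi.single j 1) w
    simp only [partialVec_eq, contrR, Algebra.TensorProduct.tmul_mul_tmul,
      LinearMap.baseChange_tmul, mul_one, LinearMap.flip_apply]
    erw [h]
    rw [TensorProduct.tmul_sub]
    congr 1
    by_cases hij : i = j
    · subst hij
      simp
    · simp [hij]
  | add P Q hP hQ =>
    rw [add_mul, map_add, hP, hQ, map_add, add_mul]
    split_ifs <;> abel

theorem one_eq_tmul : (1 : MultiVec) = (1 : SmoothFun) ⊗ₜ[ℝ] (1 : ExteriorAlgebra ℝ Space) := rfl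

theorem tmul_one_eq_smul (f : SmoothFun) :
    f ⊗ₜ[ℝ] (1 : ExteriorAlgebra ℝ Space) = f • (1 : MultiVec) := by
  rw [one_eq_tmul, TensorProduct.smul_tmul', smul_eq_mul, mul_one]

theorem contrL_apply_one (i : Fin 3) : contrL i 1 = 0 := contrL_one i 1

theorem contrR_apply_one (i : Fin 3) : contrR i 1 = 0 := by
  rw [one_eq_tmul, contrR, LinearMap.baseChange_tmul, LinearMap.flip_apply,
    CliffordAlgebra.contractRight_one, TensorProduct.tmul_zero]

theorem coeffDeriv_partialVec_mul (i j : Fin 3) (P : MultiVec) :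
    coeffDeriv i (partialVec j * P) = partialVec j * coeffDeriv i P := by
  induction P using TensorProduct.induction_on with
  | zero => simp
  | tmul g w => simp [partialVec_eq, coeffDeriv]
  | add P Q hP hQ => rw [mul_add, map_add, hP, hQ, map_add, mul_add]

theorem coeffDeriv_one (i : Fin 3) : coeffDeriv i 1 = 0 := by
  have h : pderiv i 1 = 0 := by
    simpa [constFun] using pderiv_constFun i 1
  rw [one_eq_tmul, coeffDeriv, LinearMap.rTensor_tmul, h, TensorProduct.zero_tmul]

theorem contrL_partialVec (i j : Fin 3) :
    contrL i (partialVec j) = if i = j then 1 else 0 := by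
  have h := contrL_partialVec_mul i j 1
  rwa [mul_one, contrL_apply_one, mul_zero, sub_zero] at h

theorem contrR_partialVec (i j : Fin 3) :
    contrR i (partialVec j) = if i = j then 1 else 0 := by
  have h := contrR_mul_partialVec i j 1
  rwa [one_mul, contrR_apply_one, zero_mul, sub_zero] at h

theorem coeffDeriv_partialVec (i j : Fin 3) : coeffDeriv i (partialVec j) = 0 := by
  have h := coeffDeriv_partialVec_mul i j 1
  rwa [mul_one, coeffDeriv_one, mul_zero] at h

/-- The augmentation of the exterior algebra recovers the coefficient. -/
theorem smul_one_eq_zero {f : SmoothFun} (h : f • (1 : MultiVec) = 0) : f = 0 := by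
  rw [← tmul_one_eq_smul] at h
  have h1 := congrArg (TensorProduct.rid ℝ SmoothFun ∘
    (ExteriorAlgebra.algebraMapInv (R := ℝ) (M := Space)).toLinearMap.lTensor SmoothFun) h
  simpa using h1

theorem kVec_eq_span (k : ℕ) : kVec k =
    Submodule.span SmoothFun ((fun x : ExteriorAlgebra ℝ Space => (1 : SmoothFun) ⊗ₜ[ℝ] x) ''
      (LinearMap.range (ExteriorAlgebra.ι ℝ : Space →ₗ[ℝ] _) ^ k :
        Submodule ℝ (ExteriorAlgebra ℝ Space))) := by
  rw [kVec, Submodule.baseChange_eq_span]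
  rfl

theorem tmul_mem_kVec {k : ℕ} {x : ExteriorAlgebra ℝ Space}
    (hx : x ∈ (LinearMap.range (ExteriorAlgebra.ι ℝ : Space →ₗ[ℝ] _) ^ k :
        Submodule ℝ (ExteriorAlgebra ℝ Space))) : (1 : SmoothFun) ⊗ₜ[ℝ] x ∈ kVec k := by
  rw [kVec_eq_span]
  exact Submodule.subset_span ⟨x, hx, rfl⟩

theorem mul_mem_kVec {i j : ℕ} {P Q : MultiVec} (hP : P ∈ kVec i) (hQ : Q ∈ kVec j) :
    P * Q ∈ kVec (i + j) := by
  rw [kVec_eq_span] at hP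
  induction hP using Submodule.span_induction with
  | zero => simp
  | add P P' _ _ h h' =>
    rw [add_mul]
    exact add_mem h h'
  | smul f P _ h =>
    rw [smul_mul_assoc]
    exact Submodule.smul_mem _ f h
  | mem P hP =>
    obtain ⟨x, hx, rfl⟩ := hP
    rw [kVec_eq_span] at hQ
    induction hQ using Submodule.span_induction with
    | zero => simp
    | add Q Q' _ _ h h' =>
      rw [mul_add]
      exact add_mem h h'
    | smul f Q _ h =>
      rw [mul_smul_comm]
      exact Submodule.smul_mem _ f h
    | mem Q hQ =>
      obtain ⟨y, hy, rfl⟩ := hQ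
      simp only [Algebra.TensorProduct.tmul_mul_tmul, one_mul]
      refine tmul_mem_kVec ?_
      rw [pow_add]
      exact Submodule.mul_mem_mul hx hy

theorem mul_mem_kVec_of_eq {i j k : ℕ} (h : i + j = k) {P Q : MultiVec} (hP : P ∈ kVec i)
    (hQ : Q ∈ kVec j) : P * Q ∈ kVec k :=
  h ▸ mul_mem_kVec hP hQ

theorem one_mem_kVec : (1 : MultiVec) ∈ kVec 0 := by
  refine tmul_mem_kVec ?_
  rw [pow_zero]
  exact Submodule.one_le.1 le_rfl

theorem partialVec_mem_kVec (i : Fin 3) : partialVec i ∈ kVec 1 := by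
  refine tmul_mem_kVec ?_
  rw [pow_one]
  exact ⟨_, rfl⟩

theorem coeffDeriv_mem_kVec (i : Fin 3) {k : ℕ} {P : MultiVec} (hP : P ∈ kVec k) :
    coeffDeriv i P ∈ kVec k := by
  rw [kVec_eq_span] at hP
  induction hP using Submodule.span_induction with
  | zero => simp
  | add P P' _ _ h h' =>
    rw [map_add]
    exact add_mem h h'
  | smul f P h1 h =>
    rw [← kVec_eq_span] at h1
    rw [coeffDeriv_smul]
    exact add_mem (Submodule.smul_mem _ _ h) (Submodule.smul_mem _ _ h1)
  | mem P hP =>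
    obtain ⟨x, hx, rfl⟩ := hP
    have h : pderiv i 1 = 0 := by
      simpa [constFun] using pderiv_constFun i 1
    simp [coeffDeriv, h]

theorem exists_of_mem_kVec_zero {P : MultiVec} (hP : P ∈ kVec 0) :
    ∃ f : SmoothFun, P = f • 1 := by
  rw [kVec_eq_span] at hP
  induction hP using Submodule.span_induction with
  | zero => exact ⟨0, (zero_smul _ _).symm⟩
  | add P P' _ _ h h' =>
    obtain ⟨f, rfl⟩ := h
    obtain ⟨f', rfl⟩ := h'
    exact ⟨f + f', (add_smul _ _ _).symm⟩
  | smul g P _ h =>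
    obtain ⟨f, rfl⟩ := h
    exact ⟨g * f, (mul_smul _ _ _).symm⟩
  | mem P hP =>
    obtain ⟨x, hx, rfl⟩ := hP
    rw [pow_zero] at hx
    obtain ⟨r, rfl⟩ := Submodule.mem_one.1 hx
    refine ⟨constFun r, ?_⟩
    beta_reduce
    rw [← tmul_one_eq_smul, Algebra.algebraMap_eq_smul_one, TensorProduct.tmul_smul,
      TensorProduct.smul_tmul', constFun, Algebra.algebraMap_eq_smul_one]

theorem tmul_ι_eq (v : Space) : (1 : SmoothFun) ⊗ₜ[ℝ] ExteriorAlgebra.ι ℝ v =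
    ∑ i, constFun (v i) • partialVec i := by
  have h : v = ∑ i, v i • (Pi.single i 1 : Space) := by
    conv_lhs => rw [← Finset.univ_sum_single v]
    simp [← Pi.single_smul]
  conv_lhs => rw [h]
  rw [map_sum, TensorProduct.tmul_sum]
  refine Finset.sum_congr rfl fun i _ => ?_
  rw [map_smul, TensorProduct.tmul_smul, partialVec_eq, constFun, algebraMap_smul]

/-- Splitting off one coordinate vector allows induction on the degree; iteration yields the normal
forms in degrees 1 to 3 and the vanishing above. The right-handed version serves `contrR`. -/
theorem exists_left_of_mem_kVec_succ {k : ℕ} {P : MultiVec} (hP : P ∈ kVec (k + 1)) :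
    ∃ Q : Fin 3 → MultiVec, (∀ i, Q i ∈ kVec k) ∧ P = ∑ i, partialVec i * Q i := by
  rw [kVec_eq_span] at hP
  induction hP using Submodule.span_induction with
  | zero => exact ⟨0, fun _ => zero_mem _, by simp⟩
  | add P P' _ _ h h' =>
    obtain ⟨Q, hQ, rfl⟩ := h
    obtain ⟨Q', hQ', rfl⟩ := h'
    exact ⟨Q + Q', fun i => add_mem (hQ i) (hQ' i), by simp [mul_add, Finset.sum_add_distrib]⟩
  | smul g P _ h =>
    obtain ⟨Q, hQ, rfl⟩ := h
    exact ⟨g • Q, fun i => Submodule.smul_mem _ _ (hQ i), by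
      simp [Finset.smul_sum]⟩
  | mem P hP =>
    obtain ⟨x, hx, rfl⟩ := hP
    rw [pow_succ'] at hx
    induction hx using Submodule.mul_induction_on' with
    | mem_mul_mem m hm y hy =>
      obtain ⟨v, rfl⟩ := hm
      refine ⟨fun i => constFun (v i) • (1 ⊗ₜ y), fun i => Submodule.smul_mem _ _
        (tmul_mem_kVec hy), ?_⟩
      have h : (1 : SmoothFun) ⊗ₜ[ℝ] (ExteriorAlgebra.ι ℝ v * y) =
          ((1 : SmoothFun) ⊗ₜ[ℝ] ExteriorAlgebra.ι ℝ v) * ((1 : SmoothFun) ⊗ₜ[ℝ] y) := by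
        rw [Algebra.TensorProduct.tmul_mul_tmul, one_mul]
      beta_reduce
      rw [h, tmul_ι_eq, Finset.sum_mul]
      simp
    | add x _ y _ h h' =>
      obtain ⟨Q, hQ, h⟩ := h
      obtain ⟨Q', hQ', h'⟩ := h'
      refine ⟨Q + Q', fun i => add_mem (hQ i) (hQ' i), ?_⟩
      beta_reduce at h h' ⊢
      rw [TensorProduct.tmul_add, h, h']
      simp [mul_add, Finset.sum_add_distrib]

theorem exists_right_of_mem_kVec_succ {k : ℕ} {P : MultiVec} (hP : P ∈ kVec (k + 1)) :
    ∃ Q : Fin 3 → MultiVec, (∀ i, Q i ∈ kVec k) ∧ P = ∑ i, Q i * partialVec i := by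
  rw [kVec_eq_span] at hP
  induction hP using Submodule.span_induction with
  | zero => exact ⟨0, fun _ => zero_mem _, by simp⟩
  | add P P' _ _ h h' =>
    obtain ⟨Q, hQ, rfl⟩ := h
    obtain ⟨Q', hQ', rfl⟩ := h'
    exact ⟨Q + Q', fun i => add_mem (hQ i) (hQ' i), by simp [add_mul, Finset.sum_add_distrib]⟩
  | smul g P _ h =>
    obtain ⟨Q, hQ, rfl⟩ := h
    exact ⟨g • Q, fun i => Submodule.smul_mem _ _ (hQ i), by
      simp [Finset.smul_sum]⟩
  | mem P hP =>
    obtain ⟨x, hx, rfl⟩ := hP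
    rw [pow_succ] at hx
    induction hx using Submodule.mul_induction_on' with
    | mem_mul_mem y hy m hm =>
      obtain ⟨v, rfl⟩ := hm
      refine ⟨fun i => constFun (v i) • (1 ⊗ₜ y), fun i => Submodule.smul_mem _ _
        (tmul_mem_kVec hy), ?_⟩
      have h : (1 : SmoothFun) ⊗ₜ[ℝ] (y * ExteriorAlgebra.ι ℝ v) =
          ((1 : SmoothFun) ⊗ₜ[ℝ] y) * ((1 : SmoothFun) ⊗ₜ[ℝ] ExteriorAlgebra.ι ℝ v) := by
        rw [Algebra.TensorProduct.tmul_mul_tmul, one_mul]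
      beta_reduce
      rw [h, tmul_ι_eq, Finset.mul_sum]
      simp
    | add x _ y _ h h' =>
      obtain ⟨Q, hQ, h⟩ := h
      obtain ⟨Q', hQ', h'⟩ := h'
      refine ⟨Q + Q', fun i => add_mem (hQ i) (hQ' i), ?_⟩
      beta_reduce at h h' ⊢
      rw [TensorProduct.tmul_add, h, h']
      simp [add_mul, Finset.sum_add_distrib]

theorem contrL_of_mem_kVec_zero (i : Fin 3) {P : MultiVec} (hP : P ∈ kVec 0) :
    contrL i P = 0 := by
  obtain ⟨f, rfl⟩ := exists_of_mem_kVec_zero hP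
  rw [map_smul, contrL_apply_one, smul_zero]

theorem contrR_of_mem_kVec_zero (i : Fin 3) {P : MultiVec} (hP : P ∈ kVec 0) :
    contrR i P = 0 := by
  obtain ⟨f, rfl⟩ := exists_of_mem_kVec_zero hP
  rw [map_smul, contrR_apply_one, smul_zero]

theorem contrL_mem_kVec (i : Fin 3) {k : ℕ} : ∀ {P : MultiVec}, P ∈ kVec (k + 1) →
    contrL i P ∈ kVec k := by
  induction k with
  | zero =>
    intro P hP
    obtain ⟨Q, hQ, rfl⟩ := exists_left_of_mem_kVec_succ hP
    rw [map_sum]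
    refine Submodule.sum_mem _ fun j _ => ?_
    rw [contrL_partialVec_mul, contrL_of_mem_kVec_zero i (hQ j), mul_zero, sub_zero]
    split_ifs
    exacts [hQ j, zero_mem _]
  | succ k ih =>
    intro P hP
    obtain ⟨Q, hQ, rfl⟩ := exists_left_of_mem_kVec_succ hP
    rw [map_sum]
    refine Submodule.sum_mem _ fun j _ => ?_
    rw [contrL_partialVec_mul]
    refine sub_mem ?_ (add_comm 1 k ▸ mul_mem_kVec (partialVec_mem_kVec j) (ih (hQ j)))
    split_ifs
    exacts [hQ j, zero_mem _]

theorem contrR_mem_kVec (i : Fin 3) {k : ℕ} : ∀ {P : MultiVec}, P ∈ kVec (k + 1) →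
    contrR i P ∈ kVec k := by
  induction k with
  | zero =>
    intro P hP
    obtain ⟨Q, hQ, rfl⟩ := exists_right_of_mem_kVec_succ hP
    rw [map_sum]
    refine Submodule.sum_mem _ fun j _ => ?_
    rw [contrR_mul_partialVec, contrR_of_mem_kVec_zero i (hQ j), zero_mul, sub_zero]
    split_ifs
    exacts [hQ j, zero_mem _]
  | succ k ih =>
    intro P hP
    obtain ⟨Q, hQ, rfl⟩ := exists_right_of_mem_kVec_succ hP
    rw [map_sum]
    refine Submodule.sum_mem _ fun j _ => ?_
    rw [contrR_mul_partialVec]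
    refine sub_mem ?_ (mul_mem_kVec (ih (hQ j)) (partialVec_mem_kVec j))
    split_ifs
    exacts [hQ j, zero_mem _]

/-- The Schouten bracket has degree `-1`. -/
theorem schouten_mem_kVec {i j k : ℕ} (h : i + j = k + 1) {P Q : MultiVec} (hP : P ∈ kVec i)
    (hQ : Q ∈ kVec j) : schouten P Q ∈ kVec k := by
  rw [schouten_apply]
  refine Submodule.sum_mem _ fun l _ => sub_mem ?_ ?_
  · cases i with
    | zero =>
      rw [contrR_of_mem_kVec_zero l hP, zero_mul]
      exact zero_mem _
    | succ i =>
      obtain rfl : k = i + j := by omega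
      exact mul_mem_kVec (contrR_mem_kVec l hP) (coeffDeriv_mem_kVec l hQ)
  · cases j with
    | zero =>
      rw [contrL_of_mem_kVec_zero l hQ, mul_zero]
      exact zero_mem _
    | succ j =>
      obtain rfl : k = i + j := by omega
      exact mul_mem_kVec (coeffDeriv_mem_kVec l hP) (contrL_mem_kVec l hQ)

end Grading
end PoissonR3
end

noncomputable section
namespace PoissonR3

/-! ### Normal forms and component formulas for the products and brackets -/

section Components

/-- The vector field `a ∂_x + b ∂_y + g ∂_z`. -/
def vec (a b g : SmoothFun) : MultiVec :=
  a • partialVec 0 + b • partialVec 1 + g • partialVec 2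

/-- The bivector field `q ∂_x ∧ ∂_y + α ∂_x ∧ ∂_z + β ∂_y ∧ ∂_z`. -/
def biv (q α β : SmoothFun) : MultiVec :=
  q • (partialVec 0 * partialVec 1) + α • (partialVec 0 * partialVec 2) +
    β • (partialVec 1 * partialVec 2)

/-- The trivector field `h ∂_x ∧ ∂_y ∧ ∂_z`. -/
def triv (h : SmoothFun) : MultiVec := h • (partialVec 0 * (partialVec 1 * partialVec 2))

theorem partialVec_mul_self_mul (i : Fin 3) (P : MultiVec) :
    partialVec i * (partialVec i * P) = 0 := by
  rw [← mul_assoc, partialVec_mul_self, zero_mul]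

theorem partialVec_mul_swap_mul (i j : Fin 3) (P : MultiVec) :
    partialVec i * (partialVec j * P) = -(partialVec j * (partialVec i * P)) := by
  rw [← mul_assoc, partialVec_mul_swap, neg_mul, mul_assoc]

theorem one_zero_swap : partialVec 1 * partialVec 0 = -(partialVec 0 * partialVec 1) :=
  partialVec_mul_swap 1 0
theorem two_zero_swap : partialVec 2 * partialVec 0 = -(partialVec 0 * partialVec 2) :=
  partialVec_mul_swap 2 0
theorem two_one_swap : partialVec 2 * partialVec 1 = -(partialVec 1 * partialVec 2) :=
  partialVec_mul_swap 2 1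
theorem one_zero_swap_mul (P : MultiVec) :
    partialVec 1 * (partialVec 0 * P) = -(partialVec 0 * (partialVec 1 * P)) :=
  partialVec_mul_swap_mul 1 0 P
theorem two_zero_swap_mul (P : MultiVec) :
    partialVec 2 * (partialVec 0 * P) = -(partialVec 0 * (partialVec 2 * P)) :=
  partialVec_mul_swap_mul 2 0 P
theorem two_one_swap_mul (P : MultiVec) :
    partialVec 2 * (partialVec 1 * P) = -(partialVec 1 * (partialVec 2 * P)) :=
  partialVec_mul_swap_mul 2 1 P

theorem vec_add (a b g a' b' g' : SmoothFun) :
    vec a b g + vec a' b' g' = vec (a + a') (b + b') (g + g') := by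
  simp only [vec]; module

theorem biv_add (a b g a' b' g' : SmoothFun) :
    biv a b g + biv a' b' g' = biv (a + a') (b + b') (g + g') := by
  simp only [biv]; module

theorem neg_vec (a b g : SmoothFun) : -vec a b g = vec (-a) (-b) (-g) := by
  simp only [vec]; module

theorem neg_biv (a b g : SmoothFun) : -biv a b g = biv (-a) (-b) (-g) := by
  simp only [biv]; module

theorem smul_vec (f a b g : SmoothFun) : f • vec a b g = vec (f * a) (f * b) (f * g) := by
  simp only [vec]; module

theorem smul_biv (f a b g : SmoothFun) : f • biv a b g = biv (f * a) (f * b) (f * g) := by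
  simp only [biv]; module

theorem vec_mul_vec (a b g a' b' g' : SmoothFun) : vec a b g * vec a' b' g' =
    biv (a * b' - b * a') (a * g' - g * a') (b * g' - g * b') := by
  simp only [vec, biv, mul_add, add_mul, smul_mul_assoc, mul_smul_comm, partialVec_mul_self,
    one_zero_swap, two_zero_swap, two_one_swap]
  module

theorem vec_mul_biv (a b g q α β : SmoothFun) :
    vec a b g * biv q α β = triv (a * β - b * α + g * q) := by
  simp only [vec, biv, triv, mul_add, add_mul, smul_mul_assoc, mul_smul_comm, one_zero_swap_mul,
    two_zero_swap_mul, two_one_swap_mul, two_one_swap, partialVec_mul_self_mul, partialVec_mul_self, mul_neg,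
    mul_zero, smul_zero, neg_zero]
  module

theorem biv_mul_vec (a b g q α β : SmoothFun) :
    biv q α β * vec a b g = triv (a * β - b * α + g * q) := by
  simp only [vec, biv, triv, mul_add, add_mul, smul_mul_assoc, mul_smul_comm, mul_assoc,
    one_zero_swap, two_zero_swap, two_one_swap, one_zero_swap_mul,
    partialVec_mul_self_mul, partialVec_mul_self, mul_neg, mul_zero, smul_zero, neg_zero]
  module

theorem mem_kVec_one {P : MultiVec} : P ∈ kVec 1 ↔ ∃ a b g, P = vec a b g := by
  constructor
  · intro hP
    obtain ⟨Q, hQ, rfl⟩ := exists_left_of_mem_kVec_succ hP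
    choose f hf using fun i => exists_of_mem_kVec_zero (hQ i)
    exact ⟨f 0, f 1, f 2, by simp [Fin.sum_univ_three, hf, vec]⟩
  · rintro ⟨a, b, g, rfl⟩
    exact (kVec 1).add_mem ((kVec 1).add_mem ((kVec 1).smul_mem a (partialVec_mem_kVec 0))
      ((kVec 1).smul_mem b (partialVec_mem_kVec 1))) ((kVec 1).smul_mem g (partialVec_mem_kVec 2))

theorem mem_kVec_two {P : MultiVec} : P ∈ kVec 2 ↔ ∃ q α β, P = biv q α β := by
  constructor
  · intro hP
    obtain ⟨Q, hQ, rfl⟩ := exists_left_of_mem_kVec_succ hP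
    choose a b g h using fun i => mem_kVec_one.1 (hQ i)
    refine ⟨b 0 - a 1, g 0 - a 2, g 1 - b 2, ?_⟩
    simp only [Fin.sum_univ_three, h, vec, biv, mul_add, mul_smul_comm, partialVec_mul_self,
      one_zero_swap, two_zero_swap, two_one_swap]
    module
  · rintro ⟨a, b, g, rfl⟩
    have h (i j : Fin 3) : partialVec i * partialVec j ∈ kVec 2 :=
      mul_mem_kVec_of_eq (i := 1) (j := 1) rfl (partialVec_mem_kVec i) (partialVec_mem_kVec j)
    exact (kVec 2).add_mem ((kVec 2).add_mem ((kVec 2).smul_mem a (h 0 1))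
      ((kVec 2).smul_mem b (h 0 2))) ((kVec 2).smul_mem g (h 1 2))

theorem mem_kVec_three {P : MultiVec} : P ∈ kVec 3 ↔ ∃ h, P = triv h := by
  constructor
  · intro hP
    obtain ⟨Q, hQ, rfl⟩ := exists_left_of_mem_kVec_succ hP
    choose a b g h using fun i => mem_kVec_two.1 (hQ i)
    refine ⟨g 0 - b 1 + a 2, ?_⟩
    simp only [Fin.sum_univ_three, h, triv, biv, mul_add, mul_smul_comm, partialVec_mul_self,
      one_zero_swap_mul, two_zero_swap_mul, two_one_swap_mul, two_one_swap, partialVec_mul_self_mul, mul_neg,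
      mul_zero, smul_zero, neg_zero]
    module
  · rintro ⟨h, rfl⟩
    have h3 : partialVec 0 * (partialVec 1 * partialVec 2) ∈ kVec 3 :=
      mul_mem_kVec_of_eq (i := 1) (j := 2) rfl (partialVec_mem_kVec 0)
        (mul_mem_kVec_of_eq (i := 1) (j := 1) rfl (partialVec_mem_kVec 1) (partialVec_mem_kVec 2))
    exact (kVec 3).smul_mem h h3

/-- In degree 4 a product of coordinate vectors repeats one of the three. -/
theorem eq_zero_of_mem_kVec {k : ℕ} {P : MultiVec} (hP : P ∈ kVec (k + 4)) : P = 0 := by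
  induction k generalizing P with
  | zero =>
    obtain ⟨Q, hQ, rfl⟩ := exists_left_of_mem_kVec_succ hP
    choose f hf using fun i => mem_kVec_three.1 (hQ i)
    simp only [Fin.sum_univ_three, hf, triv, mul_smul_comm, one_zero_swap_mul, two_zero_swap_mul,
      two_one_swap_mul, partialVec_mul_self_mul, partialVec_mul_self, mul_zero, smul_zero,
      neg_zero, add_zero]
  | succ k ih =>
    obtain ⟨Q, hQ, rfl⟩ := exists_left_of_mem_kVec_succ hP
    exact Finset.sum_eq_zero fun i _ => by rw [ih (hQ i), mul_zero]

theorem contrL_vec (i : Fin 3) (a b g : SmoothFun) :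
    contrL i (vec a b g) = (![a, b, g] i) • 1 := by
  fin_cases i <;> simp [vec, contrL_partialVec]

theorem contrR_vec (i : Fin 3) (a b g : SmoothFun) :
    contrR i (vec a b g) = (![a, b, g] i) • 1 := by
  fin_cases i <;> simp [vec, contrR_partialVec]

theorem contrL_biv (i : Fin 3) (q α β : SmoothFun) :
    contrL i (biv q α β) =
      vec (![0, -q, -α] i) (![q, 0, -β] i) (![α, β, 0] i) := by
  fin_cases i <;> simp [vec, biv, contrL_partialVec_mul, contrL_partialVec, ← sub_eq_add_neg]

theorem contrR_biv (i : Fin 3) (q α β : SmoothFun) :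
    contrR i (biv q α β) =
      vec (![0, q, α] i) (![-q, 0, β] i) (![-α, -β, 0] i) := by
  fin_cases i <;> simp [vec, biv, contrR_mul_partialVec, contrR_partialVec]

theorem contrL_triv (i : Fin 3) (h : SmoothFun) :
    contrL i (triv h) = biv (![0, 0, h] i) (![0, -h, 0] i) (![h, 0, 0] i) := by
  fin_cases i <;> simp [biv, triv, contrL_partialVec_mul, contrL_partialVec]

theorem coeffDeriv_vec (i : Fin 3) (a b g : SmoothFun) :
    coeffDeriv i (vec a b g) = vec (pderiv i a) (pderiv i b) (pderiv i g) := by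
  simp [vec, coeffDeriv_smul, coeffDeriv_partialVec]

theorem coeffDeriv_biv (i : Fin 3) (q α β : SmoothFun) :
    coeffDeriv i (biv q α β) = biv (pderiv i q) (pderiv i α) (pderiv i β) := by
  simp [biv, coeffDeriv_smul, coeffDeriv_partialVec_mul, coeffDeriv_partialVec]

theorem coeffDeriv_smul_one (i : Fin 3) (f : SmoothFun) :
    coeffDeriv i (f • 1) = pderiv i f • 1 := by
  simp [coeffDeriv_smul, coeffDeriv_one]

/-- Contractions lower the degree until `smul_one_eq_zero` applies; the same device separates the
coefficients in degrees 2 and 3. -/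
theorem vec_eq_zero {a b g : SmoothFun} (h : vec a b g = 0) : a = 0 ∧ b = 0 ∧ g = 0 := by
  have h1 (i : Fin 3) : ![a, b, g] i = 0 :=
    smul_one_eq_zero (by rw [← contrL_vec, h, map_zero])
  exact ⟨h1 0, h1 1, h1 2⟩

theorem biv_eq_zero {q α β : SmoothFun} (h : biv q α β = 0) : q = 0 ∧ α = 0 ∧ β = 0 := by
  have h1 (i : Fin 3) := vec_eq_zero ((contrL_biv i q α β).symm.trans (by rw [h, map_zero]))
  exact ⟨(h1 0).2.1, (h1 0).2.2, (h1 1).2.2⟩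

theorem triv_eq_zero {h : SmoothFun} (hh : triv h = 0) : h = 0 :=
  (biv_eq_zero ((contrL_triv 0 h).symm.trans (by rw [hh, map_zero]))).2.2

/-- The derivative of `f` along the vector field with components `a`, `b`, `g`. -/
def dirDeriv (a b g f : SmoothFun) : SmoothFun :=
  a * pderiv 0 f + b * pderiv 1 f + g * pderiv 2 f

theorem schouten_vec_vec (a b g a' b' g' : SmoothFun) :
    schouten (vec a b g) (vec a' b' g') =
      vec (dirDeriv a b g a' - dirDeriv a' b' g' a) (dirDeriv a b g b' - dirDeriv a' b' g' b)
        (dirDeriv a b g g' - dirDeriv a' b' g' g) := by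
  simp only [schouten_apply, contrL_vec, contrR_vec, coeffDeriv_vec, Fin.sum_univ_three,
    smul_mul_assoc, one_mul, mul_smul_comm, mul_one, Matrix.cons_val]
  simp only [vec, dirDeriv]
  module

theorem schouten_vec_biv (a b g q α β : SmoothFun) :
    schouten (vec a b g) (biv q α β) =
      biv (dirDeriv a b g q - q * pderiv 0 a - q * pderiv 1 b - α * pderiv 2 b + β * pderiv 2 a)
        (dirDeriv a b g α - α * pderiv 0 a - α * pderiv 2 g - q * pderiv 1 g - β * pderiv 1 a)
        (dirDeriv a b g β - β * pderiv 1 b - β * pderiv 2 g + q * pderiv 0 g - α * pderiv 0 b) := by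
  simp only [schouten_apply, contrL_biv, contrR_vec, coeffDeriv_vec, coeffDeriv_biv,
    Fin.sum_univ_three, smul_mul_assoc, one_mul, vec_mul_vec, Matrix.cons_val]
  simp only [biv, dirDeriv]
  module

theorem schouten_biv_vec (a b g q α β : SmoothFun) :
    schouten (biv q α β) (vec a b g) = -schouten (vec a b g) (biv q α β) := by
  rw [schouten_vec_biv]
  simp only [schouten_apply, contrR_biv, contrL_vec, coeffDeriv_vec, coeffDeriv_biv,
    Fin.sum_univ_three, mul_smul_comm, mul_one, vec_mul_vec, Matrix.cons_val]
  simp only [biv, dirDeriv]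
  module

theorem schouten_biv_biv (q α β q' α' β' : SmoothFun) :
    schouten (biv q α β) (biv q' α' β') = triv (
      q * (pderiv 0 α' + pderiv 1 β') + α * (pderiv 2 β' - pderiv 0 q')
        - β * (pderiv 1 q' + pderiv 2 α') + q' * (pderiv 0 α + pderiv 1 β)
        + α' * (pderiv 2 β - pderiv 0 q) - β' * (pderiv 1 q + pderiv 2 α)) := by
  simp only [schouten_apply, contrR_biv, contrL_biv, coeffDeriv_biv, vec_mul_biv, biv_mul_vec,
    Fin.sum_univ_three, Matrix.cons_val]
  simp only [triv]
  module

theorem schouten_biv_smul_one (q α β f : SmoothFun) :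
    schouten (biv q α β) (f • 1) = vec (q * pderiv 1 f + α * pderiv 2 f)
      (β * pderiv 2 f - q * pderiv 0 f) (-(α * pderiv 0 f + β * pderiv 1 f)) := by
  simp only [schouten_apply, contrR_biv, map_smul, contrL_apply_one, coeffDeriv_smul_one,
    Fin.sum_univ_three, mul_smul_comm, mul_one, smul_zero, mul_zero, sub_zero, Matrix.cons_val]
  simp only [vec]
  module

end Components
end PoissonR3
end

noncomputable section
namespace PoissonR3

/-! ### The Poisson complex of V ∧ ∂_z in components -/

section SpiralComplex

variable {τ : ℝ}

theorem constFun_zero : constFun 0 = 0 := map_zero _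

theorem constFun_one : constFun 1 = 1 := map_one _

@[simp] theorem pderiv_one_fun (i : Fin 3) : pderiv i (1 : SmoothFun) = 0 := by
  rw [← constFun_one, pderiv_constFun]

theorem constFun_smul (c : ℝ) (P : MultiVec) : constFun c • P = c • P :=
  algebraMap_smul SmoothFun c P

theorem eulerVec_eq : eulerVec = vec (coord 0) (coord 1) 0 := by
  simp [eulerVec, vec]

theorem rotVec_eq : rotVec = vec (-coord 1) (coord 0) 0 := by
  simp [rotVec, vec]

theorem partialVec_two_eq : partialVec 2 = vec 0 0 1 := by
  simp [vec]

theorem eulerVec_mul_partialVec : eulerVec * partialVec 2 = biv 0 (coord 0) (coord 1) := by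
  rw [eulerVec_eq, partialVec_two_eq, vec_mul_vec]
  congr 1 <;> ring

theorem spiralPoisson_eq (τ : ℝ) : spiralPoisson τ = biv 0 (spiralX τ) (spiralY τ) := by
  rw [spiralPoisson, ← constFun_smul, eulerVec_eq, rotVec_eq, partialVec_two_eq, smul_vec, vec_add,
    vec_mul_vec, spiralX, spiralY]
  congr 1 <;> ring

theorem dPoisson_smul_one (f : SmoothFun) : dPoisson (spiralPoisson τ) (f • 1) =
    vec (spiralX τ * pderiv 2 f) (spiralY τ * pderiv 2 f) (-spiralDeriv τ f) := by
  rw [dPoisson, spiralPoisson_eq, schouten_biv_smul_one, spiralDeriv]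
  congr 1 <;> ring

/-- With W = a∂_x + b∂_y this is V ∧ W_z + ([V, W] + g_z V) ∧ ∂_z. -/
theorem dPoisson_vec (a b g : SmoothFun) : dPoisson (spiralPoisson τ) (vec a b g) =
    biv (spiralX τ * pderiv 2 b - spiralY τ * pderiv 2 a)
      (spiralDeriv τ a - constFun τ * a + b + spiralX τ * pderiv 2 g)
      (spiralDeriv τ b - a - constFun τ * b + spiralY τ * pderiv 2 g) := by
  rw [dPoisson, spiralPoisson_eq, schouten_biv_vec, schouten_vec_biv, neg_biv]
  simp only [dirDeriv, spiralDeriv, map_zero, pderiv_zero_spiralX, pderiv_one_spiralX,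
    pderiv_two_spiralX, pderiv_zero_spiralY, pderiv_one_spiralY, pderiv_two_spiralY]
  congr 1 <;> ring

/-- The term 2τq comes from the divergence of V; the last two terms are the coefficient of V ∧ (α∂_x
+ β∂_y)_z. -/
theorem dPoisson_biv (q α β : SmoothFun) : dPoisson (spiralPoisson τ) (biv q α β) =
    triv (-spiralDeriv τ q + 2 * constFun τ * q - spiralY τ * pderiv 2 α +
      spiralX τ * pderiv 2 β) := by
  rw [dPoisson, spiralPoisson_eq, schouten_biv_biv]
  simp only [spiralDeriv, map_zero, pderiv_zero_spiralX, pderiv_two_spiralX, pderiv_one_spiralY,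
    pderiv_two_spiralY]
  congr 1
  ring

theorem pderiv_two_spiralDeriv (f : SmoothFun) :
    pderiv 2 (spiralDeriv τ f) = spiralDeriv τ (pderiv 2 f) := by
  simp only [spiralDeriv, map_add, pderiv_mul, pderiv_two_spiralX, pderiv_two_spiralY,
    pderiv_comm 2 0, pderiv_comm 2 1]
  ring

theorem spiralDeriv_add (f g : SmoothFun) :
    spiralDeriv τ (f + g) = spiralDeriv τ f + spiralDeriv τ g := by
  simp only [spiralDeriv, map_add]; ring

theorem spiralDeriv_sub (f g : SmoothFun) :
    spiralDeriv τ (f - g) = spiralDeriv τ f - spiralDeriv τ g := by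
  simp only [spiralDeriv, map_sub]; ring

theorem spiralDeriv_mul (f g : SmoothFun) :
    spiralDeriv τ (f * g) = f * spiralDeriv τ g + g * spiralDeriv τ f := by
  simp only [spiralDeriv, pderiv_mul]; ring

theorem spiralDeriv_spiralX : spiralDeriv τ (spiralX τ) = constFun τ * spiralX τ - spiralY τ := by
  simp only [spiralDeriv, pderiv_zero_spiralX, pderiv_one_spiralX]; ring

theorem spiralDeriv_spiralY : spiralDeriv τ (spiralY τ) = spiralX τ + constFun τ * spiralY τ := by
  simp only [spiralDeriv, pderiv_zero_spiralY, pderiv_one_spiralY]; ring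

theorem spiralDeriv_constFun (c : ℝ) : spiralDeriv τ (constFun c) = 0 := by
  simp [spiralDeriv]

theorem spiralDeriv_coord_zero : spiralDeriv τ (coord 0) = spiralX τ := by
  simp [spiralDeriv, pderiv_coord]

theorem spiralDeriv_coord_one : spiralDeriv τ (coord 1) = spiralY τ := by
  simp [spiralDeriv, pderiv_coord]

theorem spiralDeriv_coord_two : spiralDeriv τ (coord 2) = 0 := by
  simp [spiralDeriv, pderiv_coord]

theorem pderiv_two_coord_two : pderiv 2 (coord 2) = 1 := by simp [pderiv_coord]

theorem spiralX_apply_zero : (spiralX τ).1 0 = 0 := by simp [spiralX]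

theorem spiralY_apply_zero : (spiralY τ).1 0 = 0 := by simp [spiralY]

theorem spiralDeriv_apply_zero (f : SmoothFun) : (spiralDeriv τ f).1 0 = 0 := by
  simp [spiralDeriv, spiralX_apply_zero, spiralY_apply_zero]

/-- A function annihilated by the Poisson differential is constant. -/
theorem eq_constFun_of_dPoisson_eq_zero (hτ : 0 < τ) {f : SmoothFun}
    (h : dPoisson (spiralPoisson τ) (f • 1) = 0) : f = constFun (f.1 0) := by
  rw [dPoisson_smul_one] at h
  obtain ⟨h1, _, h3⟩ := vec_eq_zero h
  exact planar_const_of_spiralDeriv_eq_zero hτ (eq_zero_of_spiralX_mul h1) (neg_eq_zero.1 h3)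

/-- For W = a∂_x + b∂_y the equations say [V, W] = -g_z V. If V(k) = g_z then W + kV commutes with
V, hence is a combination of E and V. -/
theorem exists_of_planar_vec_cocycle (hτ : 0 < τ) {a b g : SmoothFun} (ha : pderiv 2 a = 0)
    (hb : pderiv 2 b = 0) (h2 : spiralDeriv τ a - constFun τ * a + b + spiralX τ * pderiv 2 g = 0)
    (h3 : spiralDeriv τ b - a - constFun τ * b + spiralY τ * pderiv 2 g = 0) :
    ∃ (c e : ℝ) (f : SmoothFun), a = constFun c * coord 0 + spiralX τ * pderiv 2 f ∧
      b = constFun c * coord 1 + spiralY τ * pderiv 2 f ∧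
      g = constFun e - spiralDeriv τ f := by
  set g1 := pderiv 2 g with hg1
  -- In the z-derivative of `h2` only `spiralX τ * pderiv 2 g1` remains.
  have hg1z : pderiv 2 g1 = 0 := by
    have h := congrArg (pderiv 2) h2
    simp only [map_add, map_sub, pderiv_mul, pderiv_two_spiralDeriv, ha, hb, pderiv_constFun,
      pderiv_two_spiralX, map_zero] at h
    refine eq_zero_of_spiralX_mul (τ := τ) ?_
    rw [← h]
    simp only [spiralDeriv, map_zero]
    ring
  -- Compare traces of the linear parts at the origin: that of [V, W] is a commutator of matrices,
  -- with trace 0, while that of g_z V has trace 2τ g_z(0).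
  have hg10 : g1.1 0 = 0 := by
    have h4 := congrArg (fun F => (pderiv 0 F).1 0) h2
    have h5 := congrArg (fun F => (pderiv 1 F).1 0) h3
    simp [spiralDeriv, pderiv_mul, spiralX_apply_zero, spiralY_apply_zero] at h4 h5
    have h6 : τ * g1.1 0 = 0 := by linarith
    exact (mul_eq_zero.1 h6).resolve_left hτ.ne'
  obtain ⟨k, hk, hVk⟩ := exists_spiralDeriv_eq hτ hg1z hg10
  have hg0z : pderiv 2 (g - coord 2 * g1 - constFun (g.1 0)) = 0 := by
    simp only [map_sub, pderiv_mul, hg1z, pderiv_constFun, pderiv_two_coord_two, ← hg1]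
    ring
  obtain ⟨f, hf, hVf⟩ := exists_spiralDeriv_eq hτ hg0z (by simp)
  obtain ⟨c, m, hc1, hc2⟩ := exists_of_spiral_commute hτ (a := a + spiralX τ * k)
    (b := b + spiralY τ * k) (by simp [pderiv_mul, ha, hk]) (by simp [pderiv_mul, hb, hk])
    (by rw [spiralDeriv_add, spiralDeriv_mul, spiralDeriv_spiralX, hVk]; linear_combination h2)
    (by rw [spiralDeriv_add, spiralDeriv_mul, spiralDeriv_spiralY, hVk]; linear_combination h3)
  have hz : pderiv 2 (coord 2 * (constFun m - k) - f) = constFun m - k := by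
    simp only [map_sub, pderiv_mul, hk, hf, pderiv_constFun, pderiv_two_coord_two]
    ring
  -- The z-derivative `constFun m - k` absorbs the V-part of W. Since V(k) = g_z, the factor z also
  -- accounts for the part of `g` linear in z, and the planar `f` for the rest up to the constant
  -- `g.1 0`.
  refine ⟨c, g.1 0, coord 2 * (constFun m - k) - f, ?_, ?_, ?_⟩
  · rw [hz]
    linear_combination hc1
  · rw [hz]
    linear_combination hc2
  · rw [spiralDeriv_sub, spiralDeriv_mul, spiralDeriv_sub, spiralDeriv_constFun,
      spiralDeriv_coord_two, hVk, hVf]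
    ring

/-- Every vector field that is a cocycle is cohomologous to a combination of `E` and `∂_z`. -/
theorem exists_of_vec_cocycle (hτ : 0 < τ) {a b g : SmoothFun}
    (h : dPoisson (spiralPoisson τ) (vec a b g) = 0) :
    ∃ (c e : ℝ) (f : SmoothFun), vec a b g =
      vec (constFun c * coord 0) (constFun c * coord 1) (constFun e) +
        dPoisson (spiralPoisson τ) (f • 1) := by
  rw [dPoisson_vec] at h
  obtain ⟨h1, h2, h3⟩ := biv_eq_zero h
  -- V ∧ W_z = 0 gives W_z = kV. With F_z = k and f_z = F one has d f = FV - V(f) ∂_z, and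
  -- subtracting it makes W independent of z.
  obtain ⟨k, hka, hkb⟩ := exists_eq_spiral_mul (sub_eq_zero.1 h1)
  obtain ⟨F, hF⟩ := exists_pderiv_two_eq k
  obtain ⟨f, hf⟩ := exists_pderiv_two_eq F
  obtain ⟨c, e, f', ha, hb, hg⟩ := exists_of_planar_vec_cocycle hτ (a := a - spiralX τ * F)
    (b := b - spiralY τ * F) (g := g + spiralDeriv τ f)
    (by rw [map_sub, pderiv_mul, pderiv_two_spiralX, hF, hka]; ring)
    (by rw [map_sub, pderiv_mul, pderiv_two_spiralY, hF, hkb]; ring)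
    (by
      rw [spiralDeriv_sub, spiralDeriv_mul, spiralDeriv_spiralX, map_add, pderiv_two_spiralDeriv,
        hf]
      linear_combination h2)
    (by
      rw [spiralDeriv_sub, spiralDeriv_mul, spiralDeriv_spiralY, map_add, pderiv_two_spiralDeriv,
        hf]
      linear_combination h3)
  refine ⟨c, e, f + f', ?_⟩
  rw [dPoisson_smul_one, vec_add, map_add, hf, spiralDeriv_add]
  congr 1
  · linear_combination ha
  · linear_combination hb
  · linear_combination hg

/-- At (1, 0, 0) the vectors E and V are independent, which forces `c = 0`; at the origin V(f)
vanishes, which forces `e = 0`. -/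
theorem eq_zero_of_vec_coboundary {c e : ℝ} {f : SmoothFun}
    (h : vec (constFun c * coord 0) (constFun c * coord 1) (constFun e) =
      dPoisson (spiralPoisson τ) (f • 1)) : c = 0 ∧ e = 0 := by
  rw [dPoisson_smul_one, ← sub_eq_zero, sub_eq_add_neg, neg_vec, vec_add] at h
  obtain ⟨h1, h2, h3⟩ := vec_eq_zero h
  have h4 := congrArg (fun F : SmoothFun => F.1 ![1, 0, 0]) h1
  have h5 := congrArg (fun F : SmoothFun => F.1 ![1, 0, 0]) h2
  have h6 := congrArg (fun F : SmoothFun => F.1 0) h3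
  simp [spiralX] at h4
  simp [spiralY] at h5
  simp [spiralDeriv_apply_zero] at h6
  rw [h5] at h4
  exact ⟨by simpa using h4, h6⟩

/-- Every bivector field that is a cocycle is cohomologous to a multiple of `E ∧ ∂_z`. -/
theorem exists_of_biv_cocycle (hτ : 0 < τ) {q α β : SmoothFun}
    (h : dPoisson (spiralPoisson τ) (biv q α β) = 0) :
    ∃ (c : ℝ) (a b g : SmoothFun), biv q α β =
      biv 0 (constFun c * coord 0) (constFun c * coord 1) +
        dPoisson (spiralPoisson τ) (vec a b g) := by
  rw [dPoisson_biv] at h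
  replace h := triv_eq_zero h
  have hτ' : 2 * constFun τ * constFun (1 / (2 * τ)) = 1 := by
    refine SmoothFun.ext fun p => ?_
    change 2 * τ * (1 / (2 * τ)) = 1
    field_simp
  -- The cocycle equation, solved for 2τq, is `spiralX τ` (q_x - β_z) + `spiralY τ` (q_y + α_z).
  -- This presents q ∂_x ∧ ∂_y as V ∧ (A∂_x + B∂_y)_z, so subtracting d(A∂_x + B∂_y) removes it.
  obtain ⟨A, hA⟩ := exists_pderiv_two_eq (-(constFun (1 / (2 * τ)) * (pderiv 1 q + pderiv 2 α)))
  obtain ⟨B, hB⟩ := exists_pderiv_two_eq (constFun (1 / (2 * τ)) * (pderiv 0 q - pderiv 2 β))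
  have hq : q = spiralX τ * pderiv 2 B - spiralY τ * pderiv 2 A := by
    rw [hA, hB]
    rw [spiralDeriv] at h
    linear_combination (-q) * hτ' + constFun (1 / (2 * τ)) * h
  set α' := α - (spiralDeriv τ A - constFun τ * A + B) with hα'
  set β' := β - (spiralDeriv τ B - A - constFun τ * B) with hβ'
  -- Once the ∂_x ∧ ∂_y part is gone, the cocycle equation says that the z-derivative of (α', β') is
  -- parallel to V.
  have hdiv : spiralX τ * pderiv 2 β' = spiralY τ * pderiv 2 α' := by
    rw [hα', hβ']
    simp only [map_sub, map_add, pderiv_mul, pderiv_constFun, pderiv_two_spiralDeriv]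
    rw [hq] at h
    simp only [spiralDeriv_sub, spiralDeriv_mul, spiralDeriv_spiralX, spiralDeriv_spiralY] at h
    linear_combination h
  obtain ⟨k, hka, hkb⟩ := exists_eq_spiral_mul hdiv
  obtain ⟨F, hF⟩ := exists_pderiv_two_eq k
  obtain ⟨g, hg⟩ := exists_pderiv_two_eq F
  obtain ⟨a, b, c, m, ha, hb, h1, h2⟩ := exists_spiral_bracket_eq hτ
    (α := α' - spiralX τ * F) (β := β' - spiralY τ * F)
    (by rw [map_sub, pderiv_mul, pderiv_two_spiralX, hF, hka]; ring)
    (by rw [map_sub, pderiv_mul, pderiv_two_spiralY, hF, hkb]; ring)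
  -- The summand mz removes the V-part of the planar cokernel, as d(mz ∂_z) = m V ∧ ∂_z.
  refine ⟨c, A + a, B + b, g + constFun m * coord 2, ?_⟩
  rw [dPoisson_vec, biv_add]
  simp only [map_add, pderiv_mul, pderiv_constFun, pderiv_two_coord_two, hg, spiralDeriv_add, ha,
    hb]
  congr 1
  · linear_combination hq
  · linear_combination h1 + hα'
  · linear_combination h2 + hβ'

/-- Compare linear parts in (x, y) at the origin. That of [V, W] is a commutator with τ + J, J the
rotation generator, hence symmetric and trace free. The J-part of the equation then gives g_z(0) = 0
and the trace gives `c = 0`. -/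
theorem eq_zero_of_biv_coboundary {c : ℝ} {a b g : SmoothFun}
    (h : biv 0 (constFun c * coord 0) (constFun c * coord 1) =
      dPoisson (spiralPoisson τ) (vec a b g)) : c = 0 := by
  rw [dPoisson_vec, ← sub_eq_zero, sub_eq_add_neg, neg_biv, biv_add] at h
  obtain ⟨_, h2, h3⟩ := biv_eq_zero h
  have h4 := congrArg (fun F => (pderiv 0 F).1 0) h2
  have h5 := congrArg (fun F => (pderiv 1 F).1 0) h2
  have h6 := congrArg (fun F => (pderiv 0 F).1 0) h3
  have h7 := congrArg (fun F => (pderiv 1 F).1 0) h3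
  simp [spiralDeriv, pderiv_mul, spiralX_apply_zero, spiralY_apply_zero, pderiv_coord]
    at h4 h5 h6 h7
  have h8 : (pderiv 2 g).1 0 = 0 := by linarith
  rw [h8] at h4 h7
  linarith

/-- Every trivector field is a coboundary. -/
theorem exists_dPoisson_eq_triv (hτ : 0 < τ) (h : SmoothFun) :
    ∃ q α β : SmoothFun, dPoisson (spiralPoisson τ) (biv q α β) = triv h := by
  set q := constFun (1 / (2 * τ)) * h with hq
  -- These choices cancel -V(q), leaving 2τq = h.
  obtain ⟨α, hα⟩ := exists_pderiv_two_eq (-pderiv 1 q)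
  obtain ⟨β, hβ⟩ := exists_pderiv_two_eq (pderiv 0 q)
  have hτ' : 2 * constFun τ * constFun (1 / (2 * τ)) = 1 := by
    refine SmoothFun.ext fun p => ?_
    change 2 * τ * (1 / (2 * τ)) = 1
    field_simp
  refine ⟨q, α, β, ?_⟩
  rw [dPoisson_biv, hα, hβ, spiralDeriv]
  congr 1
  linear_combination 2 * constFun τ * hq + h * hτ'

theorem dPoisson_dPoisson_smul_one (f : SmoothFun) :
    dPoisson (spiralPoisson τ) (dPoisson (spiralPoisson τ) (f • 1)) = 0 := by
  rw [dPoisson_smul_one, dPoisson_vec]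
  have h : biv 0 0 0 = 0 := by simp [biv]
  rw [← h]
  congr 1
  · simp only [pderiv_mul, pderiv_two_spiralX, pderiv_two_spiralY]
    ring
  · rw [spiralDeriv_mul, spiralDeriv_spiralX, map_neg, pderiv_two_spiralDeriv]
    ring
  · rw [spiralDeriv_mul, spiralDeriv_spiralY, map_neg, pderiv_two_spiralDeriv]
    ring

theorem dPoisson_dPoisson_vec (a b g : SmoothFun) :
    dPoisson (spiralPoisson τ) (dPoisson (spiralPoisson τ) (vec a b g)) = 0 := by
  rw [dPoisson_vec, dPoisson_biv]
  have h : triv 0 = 0 := by simp [triv]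
  rw [← h]
  congr 1
  simp only [spiralDeriv_sub, spiralDeriv_mul, spiralDeriv_spiralX, spiralDeriv_spiralY, map_add,
    map_sub, pderiv_mul, pderiv_two_spiralDeriv, pderiv_constFun, pderiv_two_spiralX,
    pderiv_two_spiralY]
  ring

/-- The derivation property of d, needed only for two vector fields. -/
theorem dPoisson_vec_mul_vec {a b g a' b' g' : SmoothFun}
    (h : dPoisson (spiralPoisson τ) (vec a b g) = 0)
    (h' : dPoisson (spiralPoisson τ) (vec a' b' g') = 0) :
    dPoisson (spiralPoisson τ) (vec a b g * vec a' b' g') = 0 := by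
  rw [dPoisson_vec] at h h'
  obtain ⟨h1, h2, h3⟩ := biv_eq_zero h
  obtain ⟨h1', h2', h3'⟩ := biv_eq_zero h'
  rw [vec_mul_vec, dPoisson_biv]
  have h0 : triv 0 = 0 := by simp [triv]
  rw [← h0]
  congr 1
  simp only [spiralDeriv_sub, spiralDeriv_mul, map_sub, pderiv_mul]
  linear_combination a' * h3 - b' * h2 + g' * h1 - a * h3' + b * h2' - g * h1'

/-- The bracket of a cocycle `X` with the coboundary of `f` is the coboundary of `X f`. -/
theorem schouten_vec_dPoisson {a b g : SmoothFun}
    (h : dPoisson (spiralPoisson τ) (vec a b g) = 0) (f : SmoothFun) :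
    schouten (vec a b g) (dPoisson (spiralPoisson τ) (f • 1)) =
      dPoisson (spiralPoisson τ) (dirDeriv a b g f • 1) := by
  rw [dPoisson_vec] at h
  obtain ⟨h1, h2, h3⟩ := biv_eq_zero h
  rw [dPoisson_smul_one, dPoisson_smul_one, schouten_vec_vec]
  simp only [dirDeriv, spiralDeriv, map_add, map_neg, pderiv_mul, pderiv_zero_spiralX,
    pderiv_one_spiralX, pderiv_two_spiralX, pderiv_zero_spiralY, pderiv_one_spiralY,
    pderiv_two_spiralY, pderiv_comm 2 0, pderiv_comm 2 1, pderiv_comm 1 0] at h1 h2 h3 ⊢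
  congr 1
  · linear_combination -pderiv 2 f * h2 - pderiv 1 f * h1
  · linear_combination -pderiv 2 f * h3 + pderiv 0 f * h1
  · linear_combination pderiv 0 f * h2 + pderiv 1 f * h3

theorem schouten_vec_vec_swap (a b g a' b' g' : SmoothFun) :
    schouten (vec a b g) (vec a' b' g') = -schouten (vec a' b' g') (vec a b g) := by
  rw [schouten_vec_vec, schouten_vec_vec, neg_vec]
  congr 1 <;> ring

/-- The bracket of the coboundary of `f` with a cocycle `Q` is a coboundary. -/
theorem schouten_dPoisson_biv {q α β : SmoothFun}
    (h : dPoisson (spiralPoisson τ) (biv q α β) = 0) (f : SmoothFun) :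
    schouten (dPoisson (spiralPoisson τ) (f • 1)) (biv q α β) =
      dPoisson (spiralPoisson τ) (vec (pderiv 1 f * q + pderiv 2 f * α)
        (pderiv 2 f * β - pderiv 0 f * q) (-(pderiv 0 f * α + pderiv 1 f * β))) := by
  rw [dPoisson_biv] at h
  replace h := triv_eq_zero h
  rw [dPoisson_smul_one, dPoisson_vec, schouten_vec_biv]
  simp only [dirDeriv, spiralDeriv, map_add, map_sub, map_neg, pderiv_mul, pderiv_zero_spiralX,
    pderiv_one_spiralX, pderiv_two_spiralX, pderiv_zero_spiralY, pderiv_one_spiralY,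
    pderiv_two_spiralY, pderiv_comm 2 0, pderiv_comm 2 1, pderiv_comm 1 0] at h ⊢
  congr 1
  · linear_combination -pderiv 2 f * h
  · linear_combination pderiv 1 f * h
  · linear_combination -pderiv 0 f * h

/-- The bracket of `c E + e ∂_z` with a coboundary is a coboundary. -/
theorem schouten_rep_dPoisson_vec (c e : ℝ) (a b g : SmoothFun) :
    schouten (vec (constFun c * coord 0) (constFun c * coord 1) (constFun e))
      (dPoisson (spiralPoisson τ) (vec a b g)) = dPoisson (spiralPoisson τ)
        (schouten (vec (constFun c * coord 0) (constFun c * coord 1) (constFun e)) (vec a b g)) := by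
  have hx : constFun τ * coord 0 - coord 1 = spiralX τ := rfl
  have hy : coord 0 + constFun τ * coord 1 = spiralY τ := rfl
  rw [schouten_vec_vec, dPoisson_vec, dPoisson_vec, schouten_vec_biv]
  simp only [dirDeriv, spiralDeriv, map_add, map_sub, pderiv_mul, pderiv_zero_spiralX,
    pderiv_one_spiralX, pderiv_two_spiralX, pderiv_zero_spiralY, pderiv_one_spiralY,
    pderiv_two_spiralY, pderiv_comm 2 0, pderiv_comm 2 1, pderiv_comm 1 0, pderiv_constFun,
    pderiv_coord, Fin.isValue, Fin.reduceEq, if_true, if_false, zero_mul, mul_zero,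
    add_zero, zero_add, mul_one, sub_zero]
  -- The identity uses E(`spiralX τ`) = `spiralX τ`, and likewise for `spiralY τ`, so both are
  -- expanded in coordinates.
  rw [← hx, ← hy]
  congr 1 <;> ring

theorem schouten_rep_rep (c e c' e' : ℝ) :
    schouten (vec (constFun c * coord 0) (constFun c * coord 1) (constFun e))
      (vec (constFun c' * coord 0) (constFun c' * coord 1) (constFun e')) = 0 := by
  have h : vec 0 0 0 = 0 := by simp [vec]
  rw [schouten_vec_vec, ← h]
  simp only [dirDeriv, pderiv_mul, pderiv_constFun, pderiv_coord]
  congr 1 <;> simp <;> ring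

theorem schouten_rep_biv (c e c' : ℝ) :
    schouten (vec (constFun c * coord 0) (constFun c * coord 1) (constFun e))
      (biv 0 (constFun c' * coord 0) (constFun c' * coord 1)) = 0 := by
  have h : biv 0 0 0 = 0 := by simp [biv]
  rw [schouten_vec_biv, ← h]
  simp only [dirDeriv, pderiv_mul, pderiv_constFun, pderiv_coord]
  congr 1 <;> simp <;> ring

theorem schouten_biv_rep_self (c c' : ℝ) :
    schouten (biv 0 (constFun c * coord 0) (constFun c * coord 1))
      (biv 0 (constFun c' * coord 0) (constFun c' * coord 1)) = 0 := by
  have h : triv 0 = 0 := by simp [triv]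
  rw [schouten_biv_biv, ← h]
  simp only [pderiv_mul, pderiv_constFun, pderiv_coord]
  congr 1
  simp

theorem schouten_spiralPoisson_self : schouten (spiralPoisson τ) (spiralPoisson τ) = 0 := by
  have h : triv 0 = 0 := by simp [triv]
  change dPoisson _ _ = _
  nth_rewrite 2 [spiralPoisson_eq]
  rw [dPoisson_biv, ← h]
  congr 1
  simp [spiralDeriv]

end SpiralComplex
end PoissonR3
end

noncomputable section
namespace PoissonR3

/-! ### Bases of cohomology groups and operations induced on cohomology -/

section Descent

variable {π : MultiVec}

theorem constFun_smul_mem (N : Submodule (casimirs π) MultiVec) (c : ℝ) {P : MultiVec}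
    (hP : P ∈ N) : constFun c • P ∈ N :=
  N.smul_mem (algebraMap ℝ (casimirs π) c) hP

theorem cls_eq_zero_iff {k : ℕ} (P : cocycles π k) :
    cls P = 0 ↔ (P : MultiVec) ∈ coboundaries π k := by
  rw [← map_zero cls, cls_eq_iff, ZeroMemClass.coe_zero, sub_zero]

set_option maxHeartbeats 1000000 in
set_option synthInstance.maxHeartbeats 400000 in
/-- A basis of a cohomology group over the Casimir functions, when these are constant. -/
theorem exists_basis_cohomology {n k : ℕ} 
    (hπ : ∀ f : casimirs π, ∃ c : ℝ, (f : SmoothFun) = constFun c)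
    (v : Fin n → cocycles π k)
    (hspan : ∀ P : cocycles π k, ∃ c : Fin n → ℝ,
      (P : MultiVec) - ∑ i, constFun (c i) • (v i : MultiVec) ∈ coboundaries π k)
    (hind : ∀ c : Fin n → ℝ, ∑ i, constFun (c i) • (v i : MultiVec) ∈ coboundaries π k →
      ∀ i, c i = 0) :
    ∃ b : Module.Basis (Fin n) (casimirs π) (Cohomology π k), ∀ i, b i = cls (v i) := by
  have hsum (c : Fin n → ℝ) : ∑ i, algebraMap ℝ (casimirs π) (c i) • cls (v i) =
      cls (∑ i, algebraMap ℝ (casimirs π) (c i) • v i) := by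
    rw [map_sum]
    exact Finset.sum_congr rfl fun i _ => (map_smul _ _ _).symm
  have hcoe (c : Fin n → ℝ) : ((∑ i, algebraMap ℝ (casimirs π) (c i) • v i : cocycles π k) :
      MultiVec) = ∑ i, constFun (c i) • (v i : MultiVec) := by
    rw [AddSubmonoidClass.coe_finsetSum]
    rfl
  refine ⟨Module.Basis.mk (v := fun i => cls (v i)) ?_ ?_, fun i => Module.Basis.mk_apply _ _ _⟩
  · rw [Fintype.linearIndependent_iff]
    intro g hg i
    choose c hc using fun i => hπ (g i)
    have hgc (i : Fin n) : g i = algebraMap ℝ (casimirs π) (c i) := Subtype.ext (hc i)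
    simp only [hgc] at hg
    rw [hsum, cls_eq_zero_iff, hcoe] at hg
    rw [hgc, hind c hg i, map_zero]
  · intro a _
    obtain ⟨P, rfl⟩ := cls_surjective a
    obtain ⟨c, hc⟩ := hspan P
    rw [← hcoe, ← cls_eq_iff, ← hsum] at hc
    rw [hc]
    exact Submodule.sum_mem _ fun i _ =>
      Submodule.smul_mem _ _ (Submodule.subset_span ⟨i, rfl⟩)

/-- A bilinear operation on multivector fields that respects cocycles and coboundaries descends
to cohomology. -/
theorem exists_descent {i j k : ℕ} (B : MultiVec →ₗ[ℝ] MultiVec →ₗ[ℝ] MultiVec)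
    (hZ : ∀ P ∈ cocycles π i, ∀ Q ∈ cocycles π j, B P Q ∈ cocycles π k)
    (hl : ∀ P ∈ cocycles π i, P ∈ coboundaries π i → ∀ Q ∈ cocycles π j, B P Q ∈ coboundaries π k)
    (hr : ∀ P ∈ cocycles π i, ∀ Q ∈ cocycles π j, Q ∈ coboundaries π j →
      B P Q ∈ coboundaries π k) :
    ∃ φ : Cohomology π i →ₗ[ℝ] Cohomology π j →ₗ[ℝ] Cohomology π k,
      ∀ (P : cocycles π i) (Q : cocycles π j),
        φ (cls P) (cls Q) = cls ⟨B P Q, hZ P P.2 Q Q.2⟩ := by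
  -- A real-linear choice of representatives makes bilinearity automatic; independence of the choice
  -- is the last goal.
  have hsec (l : ℕ) : ∃ σ : Cohomology π l →ₗ[ℝ] cocycles π l, ∀ a, cls (σ a) = a := by
    obtain ⟨σ, hσ⟩ := LinearMap.exists_rightInverse_of_surjective
      ((cls : cocycles π l →ₗ[casimirs π] Cohomology π l).restrictScalars ℝ)
      (LinearMap.range_eq_top.2 cls_surjective)
    exact ⟨σ, fun a => LinearMap.congr_fun hσ a⟩
  obtain ⟨σ, hσ⟩ := hsec i
  obtain ⟨ρ, hρ⟩ := hsec j
  have hsmul (c : ℝ) (P : cocycles π k) : c • cls P = cls (c • P) :=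
    (((cls : cocycles π k →ₗ[casimirs π] Cohomology π k).restrictScalars ℝ).map_smul c P).symm
  refine ⟨LinearMap.mk₂ ℝ (fun a b => cls ⟨B (σ a) (ρ b), hZ _ (σ a).2 _ (ρ b).2⟩) ?_ ?_ ?_ ?_,
    fun P Q => ?_⟩
  · intro a a' b
    rw [← map_add]
    congr 1
    exact Subtype.ext (by simp)
  · intro c a b
    rw [hsmul]
    congr 1
    exact Subtype.ext (by simp)
  · intro a b b'
    rw [← map_add]
    congr 1
    exact Subtype.ext (by simp)
  · intro c a b
    rw [hsmul]
    congr 1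
    exact Subtype.ext (by simp)
  · rw [LinearMap.mk₂_apply, cls_eq_iff]
    have h1 : ((σ (cls P) - P : cocycles π i) : MultiVec) ∈ coboundaries π i :=
      (cls_eq_iff _ _).1 (hσ _)
    have h2 : ((ρ (cls Q) - Q : cocycles π j) : MultiVec) ∈ coboundaries π j :=
      (cls_eq_iff _ _).1 (hρ _)
    -- B(σ, ρ) - B(P, Q) = B(σ - P, ρ) + B(P, ρ - Q).
    have h3 := add_mem (hl _ (σ (cls P) - P).2 h1 _ (ρ (cls Q)).2)
      (hr _ P.2 _ (ρ (cls Q) - Q).2 h2)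
    convert h3 using 1
    simp

end Descent

/-! ### Cohomology of the spiral structure and its operations -/

section SpiralCohomology

variable {τ : ℝ}

theorem mem_casimirs_iff {π : MultiVec} {f : SmoothFun} :
    f ∈ casimirs π ↔ dPoisson π (f • 1) = 0 := by
  rw [← tmul_one_eq_smul]
  rfl

theorem spiral_casimir_eq_constFun (hτ : 0 < τ) (f : casimirs (spiralPoisson τ)) :
    ∃ c : ℝ, (f : SmoothFun) = constFun c :=
  ⟨_, eq_constFun_of_dPoisson_eq_zero hτ (mem_casimirs_iff.1 f.2)⟩

theorem spiralPoisson_mem_kVec (τ : ℝ) : spiralPoisson τ ∈ kVec 2 :=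
  mem_kVec_two.2 ⟨_, _, _, spiralPoisson_eq τ⟩

theorem dPoisson_mem_kVec {k : ℕ} {P : MultiVec} (hP : P ∈ kVec k) :
    dPoisson (spiralPoisson τ) P ∈ kVec (k + 1) :=
  schouten_mem_kVec (by omega) (spiralPoisson_mem_kVec τ) hP

theorem dPoisson_dPoisson {k : ℕ} {P : MultiVec} (hP : P ∈ kVec k) :
    dPoisson (spiralPoisson τ) (dPoisson (spiralPoisson τ) P) = 0 := by
  match k, hP with
  | 0, hP =>
    obtain ⟨f, rfl⟩ := exists_of_mem_kVec_zero hP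
    exact dPoisson_dPoisson_smul_one f
  | 1, hP =>
    obtain ⟨a, b, g, rfl⟩ := mem_kVec_one.1 hP
    exact dPoisson_dPoisson_vec a b g
  | k + 2, hP => exact eq_zero_of_mem_kVec (k := k) (dPoisson_mem_kVec (dPoisson_mem_kVec hP))

theorem coboundaries_le_cocycles (k : ℕ) :
    coboundaries (spiralPoisson τ) k ≤ cocycles (spiralPoisson τ) k := by
  match k with
  | 0 => exact bot_le
  | k + 1 =>
    rintro _ ⟨P, hP, rfl⟩
    exact ⟨dPoisson_mem_kVec hP, dPoisson_dPoisson hP⟩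

theorem mem_cocycles_of_mem_kVec {k : ℕ} {P : MultiVec} (hP : P ∈ kVec (k + 3)) :
    P ∈ cocycles (spiralPoisson τ) (k + 3) :=
  ⟨hP, eq_zero_of_mem_kVec (k := k) (dPoisson_mem_kVec hP)⟩

/-- Exactness in all degrees from 3 on reduces each descent check below to a few low degrees. -/
theorem mem_coboundaries_of_mem_kVec (hτ : 0 < τ) {k : ℕ} {P : MultiVec}
    (hP : P ∈ kVec (k + 3)) : P ∈ coboundaries (spiralPoisson τ) (k + 3) := by
  match k, hP with
  | 0, hP =>
    obtain ⟨h, rfl⟩ := mem_kVec_three.1 hP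
    obtain ⟨q, α, β, hd⟩ := exists_dPoisson_eq_triv hτ h
    exact ⟨_, mem_kVec_two.2 ⟨q, α, β, rfl⟩, hd⟩
  | k + 1, hP =>
    rw [eq_zero_of_mem_kVec (k := k) hP]
    exact zero_mem _

theorem exists_of_cocycle_zero (hτ : 0 < τ) {P : MultiVec}
    (hP : P ∈ cocycles (spiralPoisson τ) 0) : ∃ c : ℝ, P = constFun c • 1 := by
  obtain ⟨f, rfl⟩ := exists_of_mem_kVec_zero hP.1
  exact ⟨_, congrArg (· • (1 : MultiVec)) (eq_constFun_of_dPoisson_eq_zero hτ hP.2)⟩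

theorem eq_zero_of_coboundary_zero {π P : MultiVec} (hP : P ∈ coboundaries π 0) : P = 0 := hP

theorem vec_mem_cocycles {a b g : SmoothFun} (h : dPoisson (spiralPoisson τ) (vec a b g) = 0) :
    vec a b g ∈ cocycles (spiralPoisson τ) 1 :=
  ⟨mem_kVec_one.2 ⟨a, b, g, rfl⟩, h⟩

/-- Degree 0 cocycles are constants and total degree at least 3 is automatic, so only two vector
fields remain. -/
theorem mul_mem_cocycles (hτ : 0 < τ) {i j k : ℕ} (h : i + j = k) {P Q : MultiVec}
    (hP : P ∈ cocycles (spiralPoisson τ) i) (hQ : Q ∈ cocycles (spiralPoisson τ) j) :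
    P * Q ∈ cocycles (spiralPoisson τ) k := by
  subst h
  rcases Nat.eq_zero_or_pos i with rfl | hi
  · obtain ⟨c, rfl⟩ := exists_of_cocycle_zero hτ hP
    rw [smul_mul_assoc, one_mul, zero_add]
    exact constFun_smul_mem _ c hQ
  rcases Nat.eq_zero_or_pos j with rfl | hj
  · obtain ⟨c, rfl⟩ := exists_of_cocycle_zero hτ hQ
    rw [mul_smul_comm, mul_one, add_zero]
    exact constFun_smul_mem _ c hP
  have hk := mul_mem_kVec hP.1 hQ.1
  by_cases h3 : 3 ≤ i + j
  · obtain ⟨l, hl⟩ := Nat.exists_eq_add_of_le' h3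
    rw [hl] at hk ⊢
    exact mem_cocycles_of_mem_kVec hk
  · obtain rfl : i = 1 := by omega
    obtain rfl : j = 1 := by omega
    refine ⟨hk, ?_⟩
    obtain ⟨a, b, g, rfl⟩ := mem_kVec_one.1 hP.1
    obtain ⟨a', b', g', rfl⟩ := mem_kVec_one.1 hQ.1
    exact dPoisson_vec_mul_vec hP.2 hQ.2

/-- For a cocycle Q, d f ∧ Q = d(fQ). -/
theorem dPoisson_smul_one_mul {f : SmoothFun} {Q : MultiVec}
    (hQ : Q ∈ cocycles (spiralPoisson τ) 1) :
    dPoisson (spiralPoisson τ) (f • 1) * Q ∈ coboundaries (spiralPoisson τ) 2 := by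
  refine ⟨f • Q, (kVec 1).smul_mem f hQ.1, ?_⟩
  rw [dPoisson_smul, hQ.2, smul_zero, zero_add, tmul_one_eq_smul]

theorem mul_mem_coboundaries_left (hτ : 0 < τ) {i j k : ℕ} (h : i + j = k) {P Q : MultiVec}
    (hP : P ∈ coboundaries (spiralPoisson τ) i) (hQ : Q ∈ cocycles (spiralPoisson τ) j) :
    P * Q ∈ coboundaries (spiralPoisson τ) k := by
  subst h
  rcases Nat.eq_zero_or_pos i with rfl | hi
  · rw [eq_zero_of_coboundary_zero hP, zero_mul]
    exact zero_mem _
  rcases Nat.eq_zero_or_pos j with rfl | hj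
  · obtain ⟨c, rfl⟩ := exists_of_cocycle_zero hτ hQ
    rw [mul_smul_comm, mul_one, add_zero]
    exact constFun_smul_mem _ c hP
  by_cases h3 : 3 ≤ i + j
  · have hk := mul_mem_kVec (coboundaries_le_cocycles _ hP).1 hQ.1
    obtain ⟨l, hl⟩ := Nat.exists_eq_add_of_le' h3
    rw [hl] at hk ⊢
    exact mem_coboundaries_of_mem_kVec hτ hk
  · obtain rfl : i = 1 := by omega
    obtain rfl : j = 1 := by omega
    obtain ⟨P, hP, rfl⟩ := hP
    obtain ⟨f, rfl⟩ := exists_of_mem_kVec_zero hP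
    exact dPoisson_smul_one_mul hQ

theorem vec_mul_vec_swap {P Q : MultiVec} (hP : P ∈ kVec 1) (hQ : Q ∈ kVec 1) :
    P * Q = -(Q * P) := by
  obtain ⟨a, b, g, rfl⟩ := mem_kVec_one.1 hP
  obtain ⟨a', b', g', rfl⟩ := mem_kVec_one.1 hQ
  rw [vec_mul_vec, vec_mul_vec, neg_biv]
  congr 1 <;> ring

theorem mul_mem_coboundaries_right (hτ : 0 < τ) {i j k : ℕ} (h : i + j = k) {P Q : MultiVec}
    (hP : P ∈ cocycles (spiralPoisson τ) i) (hQ : Q ∈ coboundaries (spiralPoisson τ) j) :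
    P * Q ∈ coboundaries (spiralPoisson τ) k := by
  subst h
  rcases Nat.eq_zero_or_pos j with rfl | hj
  · rw [eq_zero_of_coboundary_zero hQ, mul_zero]
    exact zero_mem _
  rcases Nat.eq_zero_or_pos i with rfl | hi
  · obtain ⟨c, rfl⟩ := exists_of_cocycle_zero hτ hP
    rw [smul_mul_assoc, one_mul, zero_add]
    exact constFun_smul_mem _ c hQ
  by_cases h3 : 3 ≤ i + j
  · have hk := mul_mem_kVec hP.1 (coboundaries_le_cocycles _ hQ).1
    obtain ⟨l, hl⟩ := Nat.exists_eq_add_of_le' h3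
    rw [hl] at hk ⊢
    exact mem_coboundaries_of_mem_kVec hτ hk
  · obtain rfl : i = 1 := by omega
    obtain rfl : j = 1 := by omega
    rw [vec_mul_vec_swap hP.1 (coboundaries_le_cocycles _ hQ).1]
    exact neg_mem (mul_mem_coboundaries_left hτ rfl hQ hP)

theorem schouten_one_left (c : ℝ) (Q : MultiVec) : schouten (constFun c • 1) Q = 0 := by
  rw [schouten_apply]
  refine Finset.sum_eq_zero fun i _ => ?_
  rw [map_smul, contrR_apply_one, coeffDeriv_smul_one, pderiv_constFun]
  simp

theorem schouten_one_right (c : ℝ) (P : MultiVec) : schouten P (constFun c • 1) = 0 := by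
  rw [schouten_apply]
  refine Finset.sum_eq_zero fun i _ => ?_
  rw [(contrL i).map_smul, contrL_apply_one, coeffDeriv_smul_one, pderiv_constFun]
  simp

theorem dPoisson_mem_coboundaries {π P : MultiVec} {k : ℕ} (hP : P ∈ kVec k) :
    dPoisson π P ∈ coboundaries π (k + 1) :=
  ⟨P, hP, rfl⟩

theorem smul_one_mem_kVec (f : SmoothFun) : f • (1 : MultiVec) ∈ kVec 0 :=
  (kVec 0).smul_mem f one_mem_kVec

/-- Put P = R + d f and Q = R' + d f' with R, R' combinations of E and ∂_z. Then [R, R'] = 0, [R, d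
f'] = d(R f') and [d f, Q] = -d(Q f). -/
theorem schouten_one_one_mem_coboundaries (hτ : 0 < τ) {P Q : MultiVec}
    (hP : P ∈ cocycles (spiralPoisson τ) 1) (hQ : Q ∈ cocycles (spiralPoisson τ) 1) :
    schouten P Q ∈ coboundaries (spiralPoisson τ) 1 := by
  obtain ⟨a, b, g, rfl⟩ := mem_kVec_one.1 hP.1
  obtain ⟨a', b', g', rfl⟩ := mem_kVec_one.1 hQ.1
  obtain ⟨c, e, f, h⟩ := exists_of_vec_cocycle hτ hP.2
  obtain ⟨c', e', f', h'⟩ := exists_of_vec_cocycle hτ hQ.2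
  have hrep : dPoisson (spiralPoisson τ)
      (vec (constFun c * coord 0) (constFun c * coord 1) (constFun e)) = 0 := by
    have h1 := hP.2
    rwa [h, map_add, dPoisson_dPoisson_smul_one, add_zero] at h1
  have h2 : schouten (vec a b g) (vec a' b' g') =
      dPoisson (spiralPoisson τ) (dirDeriv (constFun c * coord 0) (constFun c * coord 1)
        (constFun e) f' • 1) - dPoisson (spiralPoisson τ) (dirDeriv a' b' g' f • 1) := by
    rw [← schouten_vec_dPoisson hQ.2, ← schouten_vec_dPoisson hrep, h, map_add,
      LinearMap.add_apply]
    nth_rewrite 1 [h']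
    rw [map_add, schouten_rep_rep, zero_add, dPoisson_smul_one (f := f),
      schouten_vec_vec_swap _ _ _ a' b' g',
      sub_eq_add_neg]
  rw [h2]
  exact sub_mem (dPoisson_mem_coboundaries (smul_one_mem_kVec _))
    (dPoisson_mem_coboundaries (smul_one_mem_kVec _))

/-- Put P = R + d f and Q = R' + d W with R, R' in the span of the representatives. Then [d f, Q] is
exact because Q is a cocycle, [R, R'] = 0 and [R, d W] = d[R, W]. -/
theorem schouten_one_two_mem_coboundaries (hτ : 0 < τ) {P Q : MultiVec}
    (hP : P ∈ cocycles (spiralPoisson τ) 1) (hQ : Q ∈ cocycles (spiralPoisson τ) 2) :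
    schouten P Q ∈ coboundaries (spiralPoisson τ) 2 := by
  obtain ⟨a, b, g, rfl⟩ := mem_kVec_one.1 hP.1
  obtain ⟨q, α, β, rfl⟩ := mem_kVec_two.1 hQ.1
  obtain ⟨c, e, f, h⟩ := exists_of_vec_cocycle hτ hP.2
  obtain ⟨c', a', b', g', h'⟩ := exists_of_biv_cocycle hτ hQ.2
  rw [h, map_add, LinearMap.add_apply, schouten_dPoisson_biv hQ.2, h', map_add, schouten_rep_biv,
    zero_add, schouten_rep_dPoisson_vec, schouten_vec_vec]
  exact add_mem (dPoisson_mem_coboundaries (mem_kVec_one.2 ⟨_, _, _, rfl⟩))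
    (dPoisson_mem_coboundaries (mem_kVec_one.2 ⟨_, _, _, rfl⟩))

/-- The Schouten bracket of cocycles is a coboundary. -/
theorem schouten_mem_coboundaries (hτ : 0 < τ) {i j k : ℕ} (h : i + j = k + 1) {P Q : MultiVec}
    (hP : P ∈ cocycles (spiralPoisson τ) i) (hQ : Q ∈ cocycles (spiralPoisson τ) j) :
    schouten P Q ∈ coboundaries (spiralPoisson τ) k := by
  rcases Nat.eq_zero_or_pos i with rfl | hi
  · obtain ⟨c, rfl⟩ := exists_of_cocycle_zero hτ hP
    rw [schouten_one_left]
    exact zero_mem _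
  rcases Nat.eq_zero_or_pos j with rfl | hj
  · obtain ⟨c, rfl⟩ := exists_of_cocycle_zero hτ hQ
    rw [schouten_one_right]
    exact zero_mem _
  by_cases h3 : 3 ≤ k
  · have hk := schouten_mem_kVec h hP.1 hQ.1
    obtain ⟨l, rfl⟩ := Nat.exists_eq_add_of_le' h3
    exact mem_coboundaries_of_mem_kVec hτ hk
  have hcases : (i = 1 ∧ j = 1 ∧ k = 1) ∨ (i = 1 ∧ j = 2 ∧ k = 2) ∨ (i = 2 ∧ j = 1 ∧ k = 2) := by
    omega
  rcases hcases with ⟨rfl, rfl, rfl⟩ | ⟨rfl, rfl, rfl⟩ | ⟨rfl, rfl, rfl⟩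
  · exact schouten_one_one_mem_coboundaries hτ hP hQ
  · exact schouten_one_two_mem_coboundaries hτ hP hQ
  · have h1 := neg_mem (schouten_one_two_mem_coboundaries hτ hQ hP)
    obtain ⟨q, α, β, rfl⟩ := mem_kVec_two.1 hP.1
    obtain ⟨a, b, g, rfl⟩ := mem_kVec_one.1 hQ.1
    rwa [schouten_biv_vec]

theorem one_mem_cocycles (τ : ℝ) : (1 : MultiVec) ∈ cocycles (spiralPoisson τ) 0 := by
  refine ⟨one_mem_kVec, ?_⟩
  have h := schouten_one_right 1 (spiralPoisson τ)
  rwa [constFun_one, one_smul] at h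

theorem eulerVec_mem_cocycles (τ : ℝ) : eulerVec ∈ cocycles (spiralPoisson τ) 1 := by
  rw [eulerVec_eq]
  refine vec_mem_cocycles ?_
  have h : biv 0 0 0 = 0 := by simp [biv]
  rw [dPoisson_vec, ← h, spiralDeriv_coord_zero, spiralDeriv_coord_one]
  congr 1 <;> simp [pderiv_coord, spiralX, spiralY]

theorem partialVec_two_mem_cocycles (τ : ℝ) : partialVec 2 ∈ cocycles (spiralPoisson τ) 1 := by
  rw [partialVec_two_eq]
  refine vec_mem_cocycles ?_
  have h : biv 0 0 0 = 0 := by simp [biv]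
  rw [dPoisson_vec, ← h]
  congr 1 <;> simp [spiralDeriv]

theorem vec_rep_eq (c e : ℝ) : vec (constFun c * coord 0) (constFun c * coord 1) (constFun e) =
    constFun c • eulerVec + constFun e • partialVec 2 := by
  rw [eulerVec_eq, partialVec_two_eq, smul_vec, smul_vec, vec_add]
  congr 1 <;> ring

theorem biv_rep_eq (c : ℝ) : biv 0 (constFun c * coord 0) (constFun c * coord 1) =
    constFun c • (eulerVec * partialVec 2) := by
  rw [eulerVec_mul_partialVec, smul_biv, mul_zero]

theorem eulerVec_mul_self : eulerVec * eulerVec = 0 := by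
  rw [eulerVec_eq, vec_mul_vec]
  simp [biv, mul_comm]

theorem exists_basis_cohomology_zero (hτ : 0 < τ) (u : cocycles (spiralPoisson τ) 0)
    (hu : (u : MultiVec) = 1) :
    ∃ b : Module.Basis (Fin 1) (casimirs (spiralPoisson τ)) (Cohomology (spiralPoisson τ) 0),
      b 0 = cls u := by
  obtain ⟨b, hb⟩ := exists_basis_cohomology (spiral_casimir_eq_constFun hτ) ![u]
    (fun P => by
      obtain ⟨c, hc⟩ := exists_of_cocycle_zero hτ P.2
      exact ⟨fun _ => c, by simp [hc, hu]⟩)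
    (fun c hc i => by
      have h1 : constFun (c 0) = 0 := smul_one_eq_zero (by
        have h2 := eq_zero_of_coboundary_zero hc
        simpa [hu] using h2)
      rw [Subsingleton.elim i 0]
      exact congrArg (fun F : SmoothFun => F.1 0) h1)
  exact ⟨b, hb 0⟩

theorem exists_basis_cohomology_one (hτ : 0 < τ) (e d : cocycles (spiralPoisson τ) 1)
    (he : (e : MultiVec) = eulerVec) (hd : (d : MultiVec) = partialVec 2) :
    ∃ b : Module.Basis (Fin 2) (casimirs (spiralPoisson τ)) (Cohomology (spiralPoisson τ) 1),
      b 0 = cls e ∧ b 1 = cls d := by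
  have hsum (c : Fin 2 → ℝ) : ∑ i, constFun (c i) • ((![e, d] i : cocycles (spiralPoisson τ) 1) :
      MultiVec) = vec (constFun (c 0) * coord 0) (constFun (c 0) * coord 1) (constFun (c 1)) := by
    rw [vec_rep_eq, Fin.sum_univ_two, ← he, ← hd]
    rfl
  obtain ⟨b, hb⟩ := exists_basis_cohomology (spiral_casimir_eq_constFun hτ) ![e, d]
    (fun P => by
      obtain ⟨x, y, z, h⟩ := mem_kVec_one.1 P.2.1
      have hP := P.2.2
      rw [h] at hP
      obtain ⟨c, m, f, hf⟩ := exists_of_vec_cocycle hτ hP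
      refine ⟨![c, m], ?_⟩
      rw [hsum, h, hf]
      change vec (constFun c * coord 0) (constFun c * coord 1) (constFun m) + _ -
        vec (constFun c * coord 0) (constFun c * coord 1) (constFun m) ∈ _
      rw [add_sub_cancel_left]
      exact dPoisson_mem_coboundaries (smul_one_mem_kVec f))
    (fun c hc => by
      rw [hsum] at hc
      obtain ⟨P, hP, h⟩ := hc
      obtain ⟨f, rfl⟩ := exists_of_mem_kVec_zero hP
      exact Fin.forall_fin_two.2 (eq_zero_of_vec_coboundary h.symm))
  exact ⟨b, hb 0, hb 1⟩

theorem exists_basis_cohomology_two (hτ : 0 < τ) (w : cocycles (spiralPoisson τ) 2)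
    (hw : (w : MultiVec) = eulerVec * partialVec 2) :
    ∃ b : Module.Basis (Fin 1) (casimirs (spiralPoisson τ)) (Cohomology (spiralPoisson τ) 2),
      b 0 = cls w := by
  have hsum (c : Fin 1 → ℝ) : ∑ i, constFun (c i) • ((![w] i : cocycles (spiralPoisson τ) 2) :
      MultiVec) = biv 0 (constFun (c 0) * coord 0) (constFun (c 0) * coord 1) := by
    rw [biv_rep_eq, Fin.sum_univ_one, ← hw]
    rfl
  obtain ⟨b, hb⟩ := exists_basis_cohomology (spiral_casimir_eq_constFun hτ) ![w]
    (fun P => by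
      obtain ⟨x, y, z, h⟩ := mem_kVec_two.1 P.2.1
      have hP := P.2.2
      rw [h] at hP
      obtain ⟨c, a, b, g, hf⟩ := exists_of_biv_cocycle hτ hP
      refine ⟨fun _ => c, ?_⟩
      rw [hsum, h, hf, add_sub_cancel_left]
      exact dPoisson_mem_coboundaries (mem_kVec_one.2 ⟨_, _, _, rfl⟩))
    (fun c hc i => by
      rw [hsum] at hc
      obtain ⟨P, hP, h⟩ := hc
      obtain ⟨x, y, z, rfl⟩ := mem_kVec_one.1 hP
      rw [Subsingleton.elim i 0]
      exact eq_zero_of_biv_coboundary h.symm)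
  exact ⟨b, hb 0⟩

theorem subsingleton_cohomology_three (hτ : 0 < τ) :
    Subsingleton (Cohomology (spiralPoisson τ) 3) := by
  refine ⟨fun a b => ?_⟩
  obtain ⟨P, rfl⟩ := cls_surjective a
  obtain ⟨Q, rfl⟩ := cls_surjective b
  rw [cls_eq_iff]
  exact mem_coboundaries_of_mem_kVec (k := 0) hτ (sub_mem P.2.1 Q.2.1)

/-- The representatives `1`, `E`, `∂_z`, `E ∧ ∂_z` of the Poisson cohomology. -/
def representatives : Set MultiVec := {1, eulerVec, partialVec 2, eulerVec * partialVec 2}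

theorem mul_mem_span_representatives {P Q : MultiVec}
    (hP : P ∈ Submodule.span ℝ representatives) (hQ : Q ∈ Submodule.span ℝ representatives) :
    P * Q ∈ Submodule.span ℝ representatives := by
  have hw : eulerVec * partialVec 2 ∈ Submodule.span ℝ representatives :=
    Submodule.subset_span (by simp [representatives])
  -- Only the degree of `eulerVec` is used, so the parameter 0 is arbitrary.
  have hde : partialVec 2 * eulerVec = -(eulerVec * partialVec 2) :=
    vec_mul_vec_swap (partialVec_mem_kVec 2) (eulerVec_mem_cocycles 0).1
  refine LinearMap.BilinMap.apply_apply_mem_of_mem_span (Submodule.span ℝ representatives)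
    representatives representatives (LinearMap.mul ℝ MultiVec) ?_ P Q hP hQ
  intro x hx y hy
  rw [LinearMap.mul_apply']
  have hx' := Submodule.subset_span (R := ℝ) hx
  have hy' := Submodule.subset_span (R := ℝ) hy
  rcases hx with rfl | rfl | rfl | rfl
  · rwa [one_mul]
  · rcases hy with rfl | rfl | rfl | rfl
    · rwa [mul_one]
    · rw [eulerVec_mul_self]
      exact zero_mem _
    · exact hw
    · rw [← mul_assoc, eulerVec_mul_self, zero_mul]
      exact zero_mem _
  · rcases hy with rfl | rfl | rfl | rfl
    · rwa [mul_one]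
    · rw [hde]
      exact neg_mem hw
    · rw [partialVec_mul_self]
      exact zero_mem _
    · rw [← mul_assoc, hde, neg_mul, mul_assoc, partialVec_mul_self, mul_zero, neg_zero]
      exact zero_mem _
  · rcases hy with rfl | rfl | rfl | rfl
    · rwa [mul_one]
    · rw [mul_assoc, hde, mul_neg, ← mul_assoc, eulerVec_mul_self, zero_mul, neg_zero]
      exact zero_mem _
    · rw [mul_assoc, partialVec_mul_self, mul_zero]
      exact zero_mem _
    · rw [mul_assoc, ← mul_assoc (partialVec 2), hde, neg_mul, mul_assoc, partialVec_mul_self,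
        mul_zero, neg_zero, mul_zero]
      exact zero_mem _

theorem schouten_span_representatives {P Q : MultiVec}
    (hP : P ∈ Submodule.span ℝ representatives) (hQ : Q ∈ Submodule.span ℝ representatives) :
    schouten P Q = 0 := by
  have h1 : (1 : MultiVec) = constFun 1 • 1 := by rw [constFun_one, one_smul]
  have h2 : eulerVec = vec (constFun 1 * coord 0) (constFun 1 * coord 1) (constFun 0) := by
    rw [vec_rep_eq, constFun_one, constFun_zero, one_smul, zero_smul, add_zero]
  have h3 : partialVec 2 = vec (constFun 0 * coord 0) (constFun 0 * coord 1) (constFun 1) := by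
    rw [vec_rep_eq, constFun_one, constFun_zero, one_smul, zero_smul, zero_add]
  have h4 : eulerVec * partialVec 2 =
      biv 0 (constFun 1 * coord 0) (constFun 1 * coord 1) := by
    rw [biv_rep_eq, constFun_one, one_smul]
  refine (Submodule.mem_bot ℝ).1 (LinearMap.BilinMap.apply_apply_mem_of_mem_span ⊥
    representatives representatives schouten ?_ P Q hP hQ)
  intro x hx y hy
  rw [Submodule.mem_bot]
  rcases hx with rfl | rfl | rfl | rfl
  · rw [h1, schouten_one_left]
  · rcases hy with rfl | rfl | rfl | rfl
    · rw [h1, schouten_one_right]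
    · rw [h2, schouten_rep_rep]
    · rw [h2, h3, schouten_rep_rep]
    · rw [h4, h2, schouten_rep_biv]
  · rcases hy with rfl | rfl | rfl | rfl
    · rw [h1, schouten_one_right]
    · rw [h2, h3, schouten_rep_rep]
    · rw [h3, schouten_rep_rep]
    · rw [h4, h3, schouten_rep_biv]
  · rcases hy with rfl | rfl | rfl | rfl
    · rw [h1, schouten_one_right]
    · rw [h4, h2, schouten_biv_vec, schouten_rep_biv, neg_zero]
    · rw [h4, h3, schouten_biv_vec, schouten_rep_biv, neg_zero]
    · rw [h4, schouten_biv_rep_self]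

end SpiralCohomology
end PoissonR3
end

/-! ### Assembly of the cohomology algebra -/

theorem mainTheorem5 (τ : ℝ) (hτ : 0 < τ) :
    -- `π_τ` is a Poisson bivector field and `d_π` is a differential
    spiralPoisson τ ∈ kVec 2 ∧
    schouten (spiralPoisson τ) (spiralPoisson τ) = 0 ∧
    (∀ k : ℕ, coboundaries (spiralPoisson τ) k ≤
      cocycles (spiralPoisson τ) k) ∧
    -- the Casimir functions are the constants
    (∀ f : SmoothFun, f ∈ casimirs (spiralPoisson τ) ↔
      ∃ c : ℝ, ∀ p : Space, (f : Space → ℝ) p = c) ∧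
    ∃ (u : cocycles (spiralPoisson τ) 0)
      (e d : cocycles (spiralPoisson τ) 1)
      (w : cocycles (spiralPoisson τ) 2),
      -- the representatives `1`, `E`, `∂_z`, `E ∧ ∂_z`
      (u : MultiVec) = 1 ∧
      (e : MultiVec) = eulerVec ∧
      (d : MultiVec) = partialVec 2 ∧
      (w : MultiVec) = eulerVec * partialVec 2 ∧
      -- the cohomology groups, as modules over the Casimir functions
      (∃ b : Module.Basis (Fin 1) (casimirs (spiralPoisson τ))
          (Cohomology (spiralPoisson τ) 0),
        b 0 = cls u) ∧
      (∃ b : Module.Basis (Fin 2) (casimirs (spiralPoisson τ))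
          (Cohomology (spiralPoisson τ) 1),
        b 0 = cls e ∧ b 1 = cls d) ∧
      (∃ b : Module.Basis (Fin 1) (casimirs (spiralPoisson τ))
          (Cohomology (spiralPoisson τ) 2),
        b 0 = cls w) ∧
      Subsingleton (Cohomology (spiralPoisson τ) 3) ∧
      -- the span of the representatives is closed under `∧`, and the bracket vanishes on it
      (∀ P ∈ Submodule.span ℝ {(u : MultiVec), ↑e, ↑d, ↑w},
        ∀ Q ∈ Submodule.span ℝ {(u : MultiVec), ↑e, ↑d, ↑w},
          P * Q ∈ Submodule.span ℝ {(u : MultiVec), ↑e, ↑d, ↑w} ∧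
          schouten P Q = 0) ∧
      -- the wedge product and the bracket induced on cohomology
      ∃ (cup : ∀ i j k : ℕ, i + j = k →
            Cohomology (spiralPoisson τ) i →ₗ[ℝ]
            Cohomology (spiralPoisson τ) j →ₗ[ℝ]
            Cohomology (spiralPoisson τ) k)
        (br : ∀ i j k : ℕ, i + j = k + 1 →
            Cohomology (spiralPoisson τ) i →ₗ[ℝ]
            Cohomology (spiralPoisson τ) j →ₗ[ℝ]
            Cohomology (spiralPoisson τ) k),
        (∀ (i j k : ℕ) (h : i + j = k)
          (P : cocycles (spiralPoisson τ) i)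
          (Q : cocycles (spiralPoisson τ) j),
          ∃ R : cocycles (spiralPoisson τ) k,
            (R : MultiVec) = P * Q ∧
            cup i j k h (cls P) (cls Q) = cls R) ∧
        (∀ (i j k : ℕ) (h : i + j = k + 1)
          (P : cocycles (spiralPoisson τ) i)
          (Q : cocycles (spiralPoisson τ) j),
          ∃ R : cocycles (spiralPoisson τ) k,
            (R : MultiVec) = schouten P Q ∧
            br i j k h (cls P) (cls Q) = cls R) ∧
        -- the resulting multiplication table
        (∀ (k : ℕ) (a : Cohomology (spiralPoisson τ) k),
          cup 0 k k (Nat.zero_add k) (cls u) a = a ∧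
          cup k 0 k (Nat.add_zero k) a (cls u) = a) ∧
        cup 1 1 2 rfl (cls e) (cls e) = 0 ∧
        cup 1 1 2 rfl (cls d) (cls d) = 0 ∧
        cup 1 1 2 rfl (cls e) (cls d) = cls w ∧
        cup 1 1 2 rfl (cls d) (cls e) = -cls w ∧
        (∀ (i j k : ℕ) (h : i + j = k + 1)
          (a : Cohomology (spiralPoisson τ) i)
          (b : Cohomology (spiralPoisson τ) j),
          br i j k h a b = 0) := by
  choose cup hcup using fun (i j k : ℕ) (h : i + j = k) =>
    exists_descent (π := spiralPoisson τ) (i := i) (j := j) (k := k) (LinearMap.mul ℝ MultiVec)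
      (fun P hP Q hQ => mul_mem_cocycles hτ h hP hQ)
      (fun P _ hP Q hQ => mul_mem_coboundaries_left hτ h hP hQ)
      (fun P hP Q _ hQ => mul_mem_coboundaries_right hτ h hP hQ)
  choose br hbr using fun (i j k : ℕ) (h : i + j = k + 1) =>
    exists_descent (π := spiralPoisson τ) (i := i) (j := j) (k := k) schouten
      -- Brackets of cocycles are coboundaries; this single fact gives closure, both descent
      -- conditions and the vanishing of the induced bracket.
      (fun P hP Q hQ => coboundaries_le_cocycles k (schouten_mem_coboundaries hτ h hP hQ))
      (fun P hP _ Q hQ => schouten_mem_coboundaries hτ h hP hQ)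
      (fun P hP Q hQ _ => schouten_mem_coboundaries hτ h hP hQ)
  have hw : eulerVec * partialVec 2 ∈ cocycles (spiralPoisson τ) 2 :=
    mul_mem_cocycles hτ (i := 1) (j := 1) rfl (eulerVec_mem_cocycles τ) (partialVec_two_mem_cocycles τ)
  refine ⟨spiralPoisson_mem_kVec τ, schouten_spiralPoisson_self, coboundaries_le_cocycles,
    fun f => ⟨fun hf => ?_, ?_⟩, ⟨1, one_mem_cocycles τ⟩, ⟨eulerVec, eulerVec_mem_cocycles τ⟩,
    ⟨partialVec 2, partialVec_two_mem_cocycles τ⟩, ⟨_, hw⟩, rfl, rfl, rfl, rfl,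
    exists_basis_cohomology_zero hτ _ rfl, exists_basis_cohomology_one hτ _ _ rfl rfl,
    exists_basis_cohomology_two hτ _ rfl, subsingleton_cohomology_three hτ,
    fun P hP Q hQ => ⟨mul_mem_span_representatives hP hQ, schouten_span_representatives hP hQ⟩,
    cup, br, fun i j k h P Q => ⟨_, rfl, hcup i j k h P Q⟩,
    fun i j k h P Q => ⟨_, rfl, hbr i j k h P Q⟩, fun k a => ?_, ?_, ?_, ?_, ?_,
    fun i j k h a b => ?_⟩
  · obtain ⟨c, hc⟩ := spiral_casimir_eq_constFun hτ ⟨f, hf⟩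
    exact ⟨c, fun p => congrArg (fun F : SmoothFun => F.1 p) hc⟩
  · rintro ⟨c, hc⟩
    obtain rfl : f = constFun c := SmoothFun.ext hc
    exact (casimirs (spiralPoisson τ)).algebraMap_mem c
  · obtain ⟨P, rfl⟩ := cls_surjective a
    rw [hcup, hcup]
    exact ⟨congrArg cls (Subtype.ext (one_mul (P : MultiVec))),
      congrArg cls (Subtype.ext (mul_one (P : MultiVec)))⟩
  · rw [hcup, cls_eq_zero_iff]
    change eulerVec * eulerVec ∈ _
    rw [eulerVec_mul_self]
    exact zero_mem _
  · rw [hcup, cls_eq_zero_iff]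
    change partialVec 2 * partialVec 2 ∈ _
    rw [partialVec_mul_self]
    exact zero_mem _
  · rw [hcup]
    rfl
  · rw [hcup, ← map_neg]
    exact congrArg cls (Subtype.ext
      (vec_mul_vec_swap (partialVec_mem_kVec 2) (eulerVec_mem_cocycles τ).1))
  · obtain ⟨P, rfl⟩ := cls_surjective a
    obtain ⟨Q, rfl⟩ := cls_surjective b
    rw [hbr, cls_eq_zero_iff]
    exact schouten_mem_coboundaries hτ h P.2 Q.2
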